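/- **Conventions.** Let $G$ be a countable group and $A$ a finite set with at least two elements. $A^G$ carries the product topology and the shift action $(gx)(h)=x(g^{-1}h)$. A subshift of $A^G$ is a non-empty closed shift-invariant subset. A subshift $X\subseteq A^G$ is of finite type if there are a finite set $F\subseteq G$ and a set $\mathcal F\subseteq A^F$ such that, for all $x\in A^G$, $x\in X$ if and only if $gx\upharpoonright F\in\mathcal F$ for every $g\in G$. A factor map between subshifts is a continuous surjective $G$-equivariant map, and a subshift is sofic if it is a factor of a subshift of finite type (over a possibly different finite alphabet with at least two elements). If $G$ is finitely generated and recursively presented, with a finite symmetric generating set $S$, a subshift $Y\subseteq A^G$ is effective if there is an algorithm which, given a pattern $p\in A^F$ ($F\subseteq G$ finite) presented as a list of pairs $(w,a)$, where the $w$ are words over $S$ representing the elements of $F$ and $a$ is the value of $p$ at the element represented by $w$, decides whether there is $y\in Y$ with $y\upharpoonright F=p$ (this does not depend on $S$). The group $G$ has the strong topological Rokhlin property (STRP) if there is an action $\alpha$ in the space $\mathrm{Act}_G(\mathcal C)$ of all homomorphisms from $G$ to the group $\mathrm{Homeo}(\mathcal C)$ of homeomorphisms of the Cantor space $\mathcal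 C$ (with the topology inherited from the product $\mathrm{Homeo}(\mathcal C)^G$, where $\mathrm{Homeo}(\mathcal C)$ has the uniform topology) whose conjugacy class $\{\phi\alpha\phi^{-1}:\phi\in\mathrm{Homeo}(\mathcal C)\}$ is comeager in $\mathrm{Act}_G(\mathcal C)$. **Theorem.** Let $G$ be a countable group, and let $1\to N\to H\to G\to 1$ be a short exact sequence of groups, where $H$ is finitely generated and recursively presented and $N$ is finitely generated (so that $G$ is finitely generated and recursively presented as well). Suppose that for some finite sets $A,B$ with at least two elements each there are a sofic subshift $X\subseteq A^G$, a subshift of finite type $Z\subseteq B^G$ and a factor map $\phi:Z\to X$ such that for every effective subshift $Y\subseteq Z$ the image $\phi[Y]$ is a disjoint union of infinitely many subshifts, each a proper subset of $\phi[Y]$. Then $H$ does not have the STRP, and in particular $G$ does not have the STRP. -/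

import Mathlib

open SymbolicDynamics.FullShift

/-- The Cantor space. -/
abbrev CantorSpace : Type := ℕ → Bool

/-- The uniform topology on the group of self-homeomorphisms of the Cantor space: the topology of
uniform convergence of maps. Since the Cantor space is compact, uniform convergence is convergence
in the compact-open topology of `C(CantorSpace, CantorSpace)`, and it makes inversion continuous. -/
instance homeoCantorTopology : TopologicalSpace (CantorSpace ≃ₜ CantorSpace) :=
  TopologicalSpace.induced
    (fun f => (⟨f, f.continuous⟩ : C(CantorSpace, CantorSpace))) inferInstance

/-- The space of actions of `G` on the Cantor space by homeomorphisms, that is, of homomorphisms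
from `G` to the homeomorphism group. -/
def CantorAction (G : Type*) [Group G] : Type _ := G →* (CantorSpace ≃ₜ CantorSpace)

namespace CantorAction

variable {G : Type*} [Group G]

/-- The topology inherited from the product topology on `G → (CantorSpace ≃ₜ CantorSpace)`. -/
instance : TopologicalSpace (CantorAction G) :=
  TopologicalSpace.induced
    (fun α : G →* (CantorSpace ≃ₜ CantorSpace) => (α : G → (CantorSpace ≃ₜ CantorSpace)))
    Pi.topologicalSpace

/-- The conjugate action `g ↦ φ α(g) φ⁻¹`. -/
def conj (φ : CantorSpace ≃ₜ CantorSpace) (α : CantorAction G) : CantorAction G :=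
  (MulAut.conj φ).toMonoidHom.comp (α : G →* (CantorSpace ≃ₜ CantorSpace))

end CantorAction

/-- The strong topological Rokhlin property: some action on the Cantor space has a comeager
conjugacy class. -/
def HasSTRP (G : Type*) [Group G] : Prop :=
  ∃ α : CantorAction G,
    Set.range (fun φ : CantorSpace ≃ₜ CantorSpace => CantorAction.conj φ α) ∈
      residual (CantorAction G)

section Symbolic

variable {G A B : Type*} [Group G] [TopologicalSpace A] [TopologicalSpace B]

/-- `X` is of finite type: for some finite window `F` and some set of allowed patterns on `F`,
the points of `X` are exactly the configurations all of whose translates show an allowed pattern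
on `F`. (`mulShift g` is the shift by `g⁻¹` in the convention `(g x)(h) = x (g⁻¹ h)`; here and
below `g` runs through the whole group.) -/
def IsSFT (X : MulSubshift A G) : Prop :=
  ∃ (F : Finset G) (allowed : Set (F → A)),
    ∀ x : G → A, x ∈ X.carrier ↔ ∀ g : G, (fun f : F => mulShift g x f) ∈ allowed

/-- `φ`, of which only the restriction to `Z` matters, is a factor map from `Z` onto `X`: it is
continuous and shift-equivariant on `Z`, and it maps `Z` onto `X`. -/
structure IsFactorMap (φ : (G → B) → (G → A)) (Z : MulSubshift B G) (X : MulSubshift A G) :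
    Prop where
  continuousOn : ContinuousOn φ Z.carrier
  equivariant : ∀ g : G, ∀ z ∈ Z.carrier, φ (mulShift g z) = mulShift g (φ z)
  image_eq : φ '' Z.carrier = X.carrier

/-- The set `W` of configurations is a disjoint union of infinitely many nonempty subshifts, each
properly contained in `W`. -/
def IsInfiniteDisjointUnionOfProperSubshifts (W : Set (G → A)) : Prop :=
  ∃ 𝒴 : Set (MulSubshift A G),
    𝒴.Infinite ∧
    (∀ Y ∈ 𝒴, Y.carrier.Nonempty ∧ Y.carrier ⊂ W) ∧
    𝒴.PairwiseDisjoint MulSubshift.carrier ∧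
    ⋃ Y ∈ 𝒴, Y.carrier = W

/-- The finite list `c` of pairs (word, letter) presents the pattern `p` on the finite set `F`.
Words are written in the letters `Fin n`, the letter `i` standing for the group element `s i`, and
the elements of the alphabet are numbered by `e`. Several words may present the same position. -/
def Presents {n k : ℕ} (s : Fin n → G) (e : A ≃ Fin k) (c : List (List (Fin n) × Fin k))
    {F : Finset G} (p : F → A) : Prop :=
  ∀ (g : G) (a : A),
    (∃ w : List (Fin n), (w, e a) ∈ c ∧ (w.map s).prod = g) ↔ ∃ h : g ∈ F, p ⟨g, h⟩ = a

/-- A subshift `X` over a finitely generated group is effective: for a finite symmetric generating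
family `s` and a numbering `e` of the alphabet there is an algorithm that, given a pattern,
presented by a list of words with letters, decides whether the pattern is allowed in `X`, i.e.
occurs in a point of `X`. The algorithm has to be correct only on lists that present a pattern.
(The notion does not depend on the choice of `s` and `e`.) -/
def IsEffective (X : MulSubshift A G) : Prop :=
  ∃ (n k : ℕ) (s : Fin n → G) (e : A ≃ Fin k),
    (∀ i, ∃ j, s j = (s i)⁻¹) ∧ Subgroup.closure (Set.range s) = ⊤ ∧
    ∃ alg : List (List (Fin n) × Fin k) → Bool, Computable alg ∧
      ∀ (c : List (List (Fin n) × Fin k)) (F : Finset G) (p : F → A), Presents s e c p →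
        (alg c = true ↔ ∃ x ∈ X.carrier, ∀ f : F, x f = p f)

end Symbolic

/-- `G` has a presentation with finitely many generators and a recursively enumerable set of
relators, i.e. `G` is finitely generated and recursively presented. Relators are given as words in
the generators and their inverses (`(i, true)` is the `i`-th generator and `(i, false)` its
inverse). -/
def IsFGRecursivelyPresented (G : Type*) [Group G] : Prop :=
  ∃ (n : ℕ) (π : FreeGroup (Fin n) →* G) (R : Set (List (Fin n × Bool))),
    Function.Surjective π ∧ REPred (fun w => w ∈ R) ∧
      Subgroup.normalClosure (FreeGroup.mk '' R) = π.ker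

/-!
Let `H` have the strong topological Rokhlin property. For a labelling `f` of the Cantor space by
finitely many letters, an action `β` of `H` has a subshift of itineraries. Along a conjugacy class
only countably many such subshifts occur, because there are only countably many continuous
labellings, and each occurs on a closed set of actions. By Baire category, near a generic action
the subshift of itineraries is constant (`HasSTRP.exists_eventually_range_itinerary_eq`). Brouwer's
characterization of the Cantor space realizes every nonempty subshift as a subshift of itineraries
(`CantorAction.exists_range_itinerary_eq`), so each nonempty subshift of finite type contains a
projectively isolated subshift `Y`: there are a subshift of finite type `W` and a letter map `ψ`
such that every subshift of `W` containing all letters is mapped onto `Y`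
(`HasSTRP.exists_projectivelyIsolated`).

If `H` is recursively presented, a projectively isolated subshift is effective
(`exists_computable_of_projectivelyIsolated`): the non-occurrence of a pattern in `Y` and the
emptiness of the set of configurations of `W` with a given letter at the identity and images
avoiding a pattern are both semidecidable by compactness (`REPred.not_exists_avoiding`). A function
on words comes from a configuration on `H` iff it is unaffected by deleting relators, so no
algorithm for the word problem is needed.

As the kernel of `π : H → G` is finitely generated, the pullback of `Z` to `H` is of finite type
(`IsSFT.pullback`) and contains a projectively isolated subshift, which descends to an effective
`Y ⊆ Z`. Choose finitely many of the infinitely many disjoint subshifts with union `φ '' Y` so that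
the part of `W` over them contains all letters. This part is mapped onto all of `Y`, so these
finitely many subshifts exhaust `φ '' Y`, a contradiction (`not_hasSTRP_of_surjective`). The group
`G` is recursively presented as well (`IsFGRecursivelyPresented.quotient`), and the same argument
applies to its identity map.
-/

/-! ### Brouwer's characterization of the Cantor space -/

section Brouwer

variable {X : Type*}

/-- The cell with a given address. The cell `univ` has the empty address, and a cell `A` whose
address `l` has length `n` is cut into `A ∩ S A n`, with address `true :: l`, and `A \ S A n`, with
address `false :: l`. -/
noncomputable def cellOf (S : Set X → ℕ → Set X) : List Bool → Set X
  | [] => Set.univ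
  | b :: l => cellOf S l ∩ {x | x ∈ S (cellOf S l) l.length ↔ b = true}

open Classical in
/-- The address of the cell of a point after `n` cuts, most recent bit first. -/
noncomputable def bitsOf (S : Set X → ℕ → Set X) (x : X) : ℕ → List Bool
  | 0 => []
  | n + 1 => decide (x ∈ S (cellOf S (bitsOf S x n)) n) :: bitsOf S x n

theorem length_bitsOf (S : Set X → ℕ → Set X) (x : X) (n : ℕ) : (bitsOf S x n).length = n := by
  induction n with
  | zero => rfl
  | succ n ih => simp [bitsOf, ih]

theorem mem_cellOf_bitsOf (S : Set X → ℕ → Set X) (x : X) (n : ℕ) :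
    x ∈ cellOf S (bitsOf S x n) := by
  induction n with
  | zero => trivial
  | succ n ih => exact ⟨ih, by simp [length_bitsOf]⟩

theorem bitsOf_eq_of_mem_cellOf (S : Set X → ℕ → Set X) (x : X) (l : List Bool)
    (h : x ∈ cellOf S l) : bitsOf S x l.length = l := by
  induction l with
  | nil => rfl
  | cons b l ih =>
    have h1 := ih h.1
    have h2 : x ∈ S (cellOf S l) l.length ↔ b = true := h.2
    simp only [List.length_cons, bitsOf, h1, h2]
    simp

variable [TopologicalSpace X]

/-- Brouwer's characterization of the Cantor space: a nonempty compact space whose points are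
separated by countably many clopen sets, and in which each nonempty clopen set can be split, is
homeomorphic to the Cantor space. The homeomorphism sends a point to the sequence of bits of the
addresses of its cells; all cells are nonempty, and points are separated because the `n`-th
separating set is used for the `n`-th cut wherever it cuts. -/
theorem nonempty_homeomorph_cantorSpace [CompactSpace X] [Nonempty X] (U : ℕ → Set X)
    (hU : ∀ n, IsClopen (U n)) (hsep : ∀ x y, (∀ n, x ∈ U n ↔ y ∈ U n) → x = y)
    (hsplit : ∀ A : Set X, IsClopen A → A.Nonempty →
      ∃ V, IsClopen V ∧ (A ∩ V).Nonempty ∧ (A \ V).Nonempty) :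
    Nonempty (X ≃ₜ CantorSpace) := by
  classical
  -- cut a cell with the next separating set if this is possible, otherwise with any clopen set
  have hS : ∀ (A : Set X) (n : ℕ), ∃ V : Set X, IsClopen V ∧
      ((A ∩ U n).Nonempty → (A \ U n).Nonempty → V = U n) ∧
      (IsClopen A → A.Nonempty → (A ∩ V).Nonempty ∧ (A \ V).Nonempty) := by
    intro A n
    by_cases h : (A ∩ U n).Nonempty ∧ (A \ U n).Nonempty
    · exact ⟨U n, hU n, fun _ _ => rfl, fun _ _ => h⟩
    · by_cases hA : IsClopen A ∧ A.Nonempty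
      · obtain ⟨V, hV, h1, h2⟩ := hsplit A hA.1 hA.2
        exact ⟨V, hV, fun h1 h2 => (h ⟨h1, h2⟩).elim, fun _ _ => ⟨h1, h2⟩⟩
      · exact ⟨∅, isClopen_empty, fun h1 h2 => (h ⟨h1, h2⟩).elim, fun h1 h2 => (hA ⟨h1, h2⟩).elim⟩
  choose S hSc hSU hSs using hS
  have hcell : ∀ l, IsClopen (cellOf S l) ∧ (cellOf S l).Nonempty := by
    intro l
    induction l with
    | nil => exact ⟨isClopen_univ, Set.univ_nonempty⟩
    | cons b l ih =>
      have h1 := hSs (cellOf S l) l.length ih.1 ih.2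
      cases b with
      | true =>
        have : cellOf S (true :: l) = cellOf S l ∩ S (cellOf S l) l.length := by
          ext x; simp [cellOf]
        rw [this]
        exact ⟨ih.1.inter (hSc _ _), h1.1⟩
      | false =>
        have : cellOf S (false :: l) = cellOf S l \ S (cellOf S l) l.length := by
          ext x; simp [cellOf]
        rw [this]
        exact ⟨ih.1.diff (hSc _ _), h1.2⟩
  let f : X → CantorSpace := fun x n => decide (x ∈ S (cellOf S (bitsOf S x n)) n)
  have hbits : ∀ x y, f x = f y → ∀ n, bitsOf S x n = bitsOf S y n := by
    intro x y h n
    induction n with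
    | zero => rfl
    | succ n ih =>
      have : f x n = f y n := by rw [h]
      simp only [bitsOf, ← ih] at this ⊢
      simp only [f, ← ih] at this
      rw [this]
  have hcont : Continuous f := by
    refine continuous_pi fun n => ?_
    refine (IsLocallyConstant.iff_exists_open _).2 (fun x => ?_) |>.continuous
    refine ⟨cellOf S (bitsOf S x (n + 1)), (hcell _).1.isOpen, mem_cellOf_bitsOf S x _, ?_⟩
    intro y hy
    have h1 := bitsOf_eq_of_mem_cellOf S y _ hy
    rw [length_bitsOf] at h1
    simp only [bitsOf, List.cons.injEq] at h1
    exact h1.1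
  have hinj : Function.Injective f := by
    intro x y h
    refine hsep x y fun n => ?_
    have hb := hbits x y h n
    have hx := mem_cellOf_bitsOf S x n
    have hy := mem_cellOf_bitsOf S y n
    have hn : f x n = f y n := by rw [h]
    simp only [f, ← hb, decide_eq_decide] at hn
    rw [← hb] at hy
    by_contra hne
    have hSU' := hSU (cellOf S (bitsOf S x n)) n
    by_cases hxu : x ∈ U n
    · have hyu : y ∉ U n := fun hyu => hne ⟨fun _ => hyu, fun _ => hxu⟩
      rw [hSU' ⟨x, hx, hxu⟩ ⟨y, hy, hyu⟩] at hn
      exact hne hn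
    · have hyu : y ∈ U n := by
        by_contra hyu
        exact hne ⟨fun h => (hxu h).elim, fun h => (hyu h).elim⟩
      rw [hSU' ⟨y, hy, hyu⟩ ⟨x, hx, hxu⟩] at hn
      exact hne hn
  have hsurj : Function.Surjective f := by
    intro b
    let l : ℕ → List Bool := fun n => Nat.rec [] (fun n l => b n :: l) n
    have hl : ∀ n, (l n).length = n := fun n => by
      induction n with
      | zero => rfl
      | succ n ih => simpa [l] using ih
    obtain ⟨x, hx⟩ := IsCompact.nonempty_iInter_of_sequence_nonempty_isCompact_isClosed
      (fun n => cellOf S (l n)) (fun n => Set.inter_subset_left) (fun n => (hcell _).2)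
      (hcell _).1.isClosed.isCompact (fun n => (hcell _).1.isClosed)
    refine ⟨x, funext fun n => ?_⟩
    have this : bitsOf S x (n + 1) = b n :: l n :=
      (congrArg (bitsOf S x) (hl (n + 1))).symm.trans
        (bitsOf_eq_of_mem_cellOf S x _ (Set.mem_iInter.1 hx (n + 1)))
    simp only [bitsOf, List.cons.injEq] at this
    exact this.1
  exact ⟨hcont.homeoOfEquivCompactToT2 (f := Equiv.ofBijective f ⟨hinj, hsurj⟩)⟩

end Brouwer

section CantorFibres

theorem CantorSpace.exists_update_not_mem {y : CantorSpace} {V : Set CantorSpace}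
    (hV : V ∈ nhds y) : ∃ m, Function.update y m (!y m) ∈ V := by
  -- the points that differ from `y` in one coordinate only converge to `y`
  have : Filter.Tendsto (fun m => Function.update y m (!y m)) Filter.atTop (nhds y) := by
    refine tendsto_pi_nhds.2 fun i => tendsto_const_nhds.congr' ?_
    filter_upwards [Filter.eventually_gt_atTop i] with m hm
    rw [Function.update_of_ne (by omega)]
  exact (this.eventually hV).exists

variable {X : Type*} [TopologicalSpace X]

/-- If each point of `X` lies on a section of a continuous map from `X` to the Cantor space, then
every nonempty clopen set of `X` can be split, by a coordinate of that map. -/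
theorem IsClopen.exists_split_of_cantorSpace {s : X → CantorSpace} (hs : Continuous s)
    (hsec : ∀ x, ∃ t : CantorSpace → X, Continuous t ∧ t (s x) = x ∧ ∀ y, s (t y) = y)
    {A : Set X} (hA : IsClopen A) (hne : A.Nonempty) :
    ∃ V, IsClopen V ∧ (A ∩ V).Nonempty ∧ (A \ V).Nonempty := by
  obtain ⟨x, hx⟩ := hne
  obtain ⟨t, ht, htx, hst⟩ := hsec x
  obtain ⟨m, hm⟩ := CantorSpace.exists_update_not_mem
    ((hA.isOpen.preimage ht).mem_nhds (show s x ∈ t ⁻¹' A by simpa [htx] using hx))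
  have hc : ∀ b : Bool, IsClopen {x' | s x' m = b} := fun b =>
    (isClopen_discrete {b}).preimage ((continuous_apply m).comp hs)
  refine ⟨{x' | s x' m = s x m}, hc _, ⟨x, hx, rfl⟩, ⟨_, hm, ?_⟩⟩
  simp [hst]

theorem IsClopen.nonempty_homeomorph_cantorSpace [CompactSpace X] {ι : Type*} [Countable ι]
    [Nonempty ι] (U : ι → Set X)
    (hU : ∀ n, IsClopen (U n)) (hsep : ∀ x y, (∀ n, x ∈ U n ↔ y ∈ U n) → x = y)
    (hsplit : ∀ A : Set X, IsClopen A → A.Nonempty →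
      ∃ V, IsClopen V ∧ (A ∩ V).Nonempty ∧ (A \ V).Nonempty)
    {D : Set X} (hD : IsClopen D) (hne : D.Nonempty) : Nonempty (D ≃ₜ CantorSpace) := by
  have : CompactSpace D := isCompact_iff_compactSpace.1 hD.isClosed.isCompact
  have : Nonempty D := hne.to_subtype
  obtain ⟨r, hr⟩ := exists_surjective_nat ι
  refine _root_.nonempty_homeomorph_cantorSpace (fun n => Subtype.val ⁻¹' U (r n))
    (fun n => (hU _).preimage continuous_subtype_val) (fun x y h => Subtype.ext (hsep _ _ ?_)) ?_
  · intro i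
    obtain ⟨n, rfl⟩ := hr i
    exact h n
  · intro A hA hAne
    obtain ⟨V, hV, ⟨x, ⟨x', hx', rfl⟩, hxV⟩, ⟨z, ⟨z', hz', rfl⟩, hzV⟩⟩ :=
      hsplit (Subtype.val '' A)
        ⟨hD.isClosed.isClosedEmbedding_subtypeVal.isClosedMap _ hA.isClosed,
          hD.isOpen.isOpenEmbedding_subtypeVal.isOpenMap _ hA.isOpen⟩ (hAne.image _)
    exact ⟨Subtype.val ⁻¹' V, hV.preimage continuous_subtype_val, ⟨x', hx', hxV⟩, ⟨z', hz', hzV⟩⟩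

theorem continuous_glue_fibres {X' σ : Type*} [TopologicalSpace X'] [TopologicalSpace σ]
    [DiscreteTopology σ] {p : X → σ} {q : X' → σ} (hp : Continuous p)
    (e : ∀ a, p ⁻¹' {a} ≃ₜ q ⁻¹' {a}) : Continuous fun x => (e (p x) ⟨x, rfl⟩ : X') := by
  refine continuous_iff_continuousAt.2 fun y => ?_
  have hopen : IsOpen (p ⁻¹' {p y}) := (isOpen_discrete _).preimage hp
  refine ContinuousOn.continuousAt (s := p ⁻¹' {p y}) ?_ (hopen.mem_nhds rfl)
  rw [continuousOn_iff_continuous_domRestrict]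
  refine (continuous_subtype_val.comp (e (p y)).continuous).congr ?_
  have : ∀ (a : σ) (x : X) (hx : p x = a), (e a ⟨x, hx⟩ : X') = e (p x) ⟨x, rfl⟩ := by
    rintro _ x rfl; rfl
  exact fun x => this _ x.1 x.2

/-- Homeomorphisms between corresponding fibres over a discrete space can be glued. -/
theorem exists_homeomorph_of_fibres {X' σ : Type*} [TopologicalSpace X'] [TopologicalSpace σ]
    [DiscreteTopology σ] {p : X → σ} {q : X' → σ} (hp : Continuous p) (hq : Continuous q)
    (h : ∀ a, Nonempty (p ⁻¹' {a} ≃ₜ q ⁻¹' {a})) : ∃ Θ : X ≃ₜ X', ∀ x, q (Θ x) = p x := by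
  let e : ∀ a, p ⁻¹' {a} ≃ₜ q ⁻¹' {a} := fun a => (h a).some
  have he : ∀ (a : σ) (x : X) (hx : p x = a), (e (p x) ⟨x, rfl⟩ : X') = e a ⟨x, hx⟩ := by
    rintro _ x rfl; rfl
  have he' : ∀ (a : σ) (x : X') (hx : q x = a),
      ((e (q x)).symm ⟨x, rfl⟩ : X) = (e a).symm ⟨x, hx⟩ := by
    rintro _ x rfl; rfl
  have hq' : ∀ x, q (e (p x) ⟨x, rfl⟩) = p x := fun x => (e (p x) ⟨x, rfl⟩).2
  have hp' : ∀ x, p ((e (q x)).symm ⟨x, rfl⟩) = q x := fun x => ((e (q x)).symm ⟨x, rfl⟩).2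
  exact ⟨{ toFun := fun x => e (p x) ⟨x, rfl⟩
           invFun := fun x => (e (q x)).symm ⟨x, rfl⟩
           left_inv := fun x => (he' _ _ (hq' x)).trans
             (congrArg Subtype.val ((e (p x)).symm_apply_apply ⟨x, rfl⟩))
           right_inv := fun x => (he _ _ (hp' x)).trans
             (congrArg Subtype.val ((e (q x)).apply_symm_apply ⟨x, rfl⟩))
           continuous_toFun := continuous_glue_fibres hp e
           continuous_invFun := continuous_glue_fibres hq fun a => (e a).symm }, hq'⟩

/-- The product of a closed set `K` of configurations with the Cantor space is the Cantor space,
and the homeomorphism can be chosen so that it carries the letter at the identity to a prescribed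
partition of the Cantor space whose parts are indexed by the letters that occur there. -/
theorem exists_homeomorph_prod_cantorSpace {H σ : Type*} [Group H] [Countable H] [Finite σ]
    [TopologicalSpace σ] [DiscreteTopology σ] {K : Set (H → σ)} (hK : IsClosed K)
    {P : CantorSpace → σ} (hP : Continuous P) (hPK : ∀ a, (∃ y, P y = a) ↔ ∃ w ∈ K, w 1 = a) :
    ∃ Θ : (K × CantorSpace) ≃ₜ CantorSpace, ∀ x, P (Θ x) = x.1.1 1 := by
  have : CompactSpace K := isCompact_iff_compactSpace.1 hK.isCompact
  have hp : Continuous fun x : K × CantorSpace => x.1.1 1 :=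
    (continuous_apply 1).comp (continuous_subtype_val.comp continuous_fst)
  refine exists_homeomorph_of_fibres hp hP fun a => ?_
  by_cases ha : ∃ y, P y = a
  · have h1 : Nonempty (P ⁻¹' {a} ≃ₜ CantorSpace) := by
      refine IsClopen.nonempty_homeomorph_cantorSpace (ι := ℕ)
        (fun n => {y : CantorSpace | y n = true})
        (fun n => (isClopen_discrete {true}).preimage (continuous_apply n)) ?_ ?_
        ((isClopen_discrete {a}).preimage hP) ha
      · exact fun x y h => funext fun n => Bool.eq_iff_iff.2 (h n)
      · exact fun A hA hne => hA.exists_split_of_cantorSpace continuous_id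
          (fun x => ⟨id, continuous_id, rfl, fun _ => rfl⟩) hne
    have h2 : Nonempty ((fun x : K × CantorSpace => x.1.1 1) ⁻¹' {a} ≃ₜ CantorSpace) := by
      refine IsClopen.nonempty_homeomorph_cantorSpace (ι := (H × σ) ⊕ ℕ)
        (Sum.elim (fun i => {x | x.1.1 i.1 = i.2}) fun n => {x | x.2 n = true}) ?_ ?_ ?_
        ((isClopen_discrete {a}).preimage hp) ?_
      · rintro (⟨h, b⟩ | n)
        · exact (isClopen_discrete {b}).preimage
            ((continuous_apply h).comp (continuous_subtype_val.comp continuous_fst))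
        · exact (isClopen_discrete {true}).preimage ((continuous_apply n).comp continuous_snd)
      · rintro x y h
        refine Prod.ext (Subtype.ext (funext fun g => ?_)) (funext fun n => ?_)
        · exact ((h (Sum.inl (g, x.1.1 g))).1 rfl).symm
        · exact Bool.eq_iff_iff.2 (h (Sum.inr n))
      · exact fun A hA hne => hA.exists_split_of_cantorSpace continuous_snd
          (fun x => ⟨fun y => (x.1, y), by fun_prop, rfl, fun _ => rfl⟩) hne
      · obtain ⟨w, hw, hw1⟩ := (hPK a).1 ha
        exact ⟨(⟨w, hw⟩, fun _ => true), hw1⟩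
    exact ⟨h2.some.trans h1.some.symm⟩
  · have h1 : IsEmpty (P ⁻¹' {a}) := ⟨fun y => ha ⟨y, y.2⟩⟩
    have h2 : IsEmpty ((fun x : K × CantorSpace => x.1.1 1) ⁻¹' {a}) :=
      ⟨fun x => ha ((hPK a).2 ⟨_, x.1.1.2, x.2⟩)⟩
    exact ⟨Homeomorph.empty⟩

end CantorFibres

/-! ### Actions on the Cantor space and their itineraries -/

open scoped Uniformity

namespace CantorAction

variable {H σ : Type*} [Group H]

/-- The homeomorphism by which a group element acts. -/
def act (β : CantorAction H) (g : H) : CantorSpace ≃ₜ CantorSpace :=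
  (show H →* (CantorSpace ≃ₜ CantorSpace) from β) g

theorem act_one (β : CantorAction H) (x : CantorSpace) : β.act 1 x = x :=
  congrArg (fun f : CantorSpace ≃ₜ CantorSpace => f x)
    (map_one (show H →* (CantorSpace ≃ₜ CantorSpace) from β))

theorem act_mul (β : CantorAction H) (g h : H) (x : CantorSpace) :
    β.act (g * h) x = β.act g (β.act h x) :=
  congrArg (fun f : CantorSpace ≃ₜ CantorSpace => f x)
    (map_mul (show H →* (CantorSpace ≃ₜ CantorSpace) from β) g h)

/-- An action as a family of continuous maps. -/
def toContinuousMaps (β : CantorAction H) (g : H) : C(CantorSpace, CantorSpace) :=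
  ⟨β.act g, (β.act g).continuous⟩

/-- Actions form a closed subspace of the space of families of continuous maps, because the
identity `β (g * g⁻¹) = 1` makes invertibility automatic. -/
theorem isClosedEmbedding_toContinuousMaps :
    Topology.IsClosedEmbedding (toContinuousMaps : CantorAction H → _) := by
  have hind : Topology.IsInducing (toContinuousMaps : CantorAction H → _) := by
    have h1 : Topology.IsInducing
        (fun (f : CantorSpace ≃ₜ CantorSpace) =>
          (⟨f, f.continuous⟩ : C(CantorSpace, CantorSpace))) :=
      ⟨rfl⟩
    have h2 : Topology.IsInducing (fun (β : CantorAction H) (g : H) => β.act g) := ⟨rfl⟩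
    exact (Topology.IsInducing.piMap fun _ : H => h1).comp h2
  refine ⟨⟨hind, fun β γ h => ?_⟩, ?_⟩
  · refine MonoidHom.ext fun g => Homeomorph.ext fun x => ?_
    exact congrArg (fun f : C(CantorSpace, CantorSpace) => f x) (congrFun h g)
  · have hr : Set.range (toContinuousMaps : CantorAction H → _) =
        {F : H → C(CantorSpace, CantorSpace) | F 1 = ContinuousMap.id _} ∩
          ⋂ p : H × H, {F | F (p.1 * p.2) = (F p.1).comp (F p.2)} := by
      ext F
      constructor
      · rintro ⟨β, rfl⟩
        refine ⟨ContinuousMap.ext β.act_one, Set.mem_iInter.2 fun p => ?_⟩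
        exact ContinuousMap.ext (β.act_mul p.1 p.2)
      · rintro ⟨h1, h2⟩
        have hmul : ∀ g h x, F (g * h) x = F g (F h x) := fun g h x =>
          congrArg (fun f : C(CantorSpace, CantorSpace) => f x) (Set.mem_iInter.1 h2 (g, h))
        have hone : ∀ x, F 1 x = x := fun x =>
          congrArg (fun f : C(CantorSpace, CantorSpace) => f x) h1
        let e : H → (CantorSpace ≃ₜ CantorSpace) := fun g =>
          { toFun := F g
            invFun := F g⁻¹
            left_inv := fun x => by rw [← hmul, inv_mul_cancel, hone]
            right_inv := fun x => by rw [← hmul, mul_inv_cancel, hone]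
            continuous_toFun := (F g).continuous
            continuous_invFun := (F g⁻¹).continuous }
        let β : H →* (CantorSpace ≃ₜ CantorSpace) :=
          { toFun := e
            map_one' := Homeomorph.ext hone
            map_mul' := fun g h => Homeomorph.ext (hmul g h) }
        exact ⟨β, rfl⟩
    rw [hr]
    refine (isClosed_eq (continuous_apply _) continuous_const).inter
      (isClosed_iInter fun p => isClosed_eq (continuous_apply _) ?_)
    exact (continuous_apply p.1).compCM (continuous_apply p.2)

theorem baireSpace [Countable H] : BaireSpace (CantorAction H) := by
  have : (𝓤 Bool).IsCountablyGenerated :=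
    (inferInstance : (Filter.principal (SetRel.id : SetRel Bool Bool)).IsCountablyGenerated)
  have := (isClosedEmbedding_toContinuousMaps (H := H)).IsCompletelyPseudoMetrizableSpace
  infer_instance

theorem continuous_act (g : H) :
    Continuous fun p : CantorAction H × CantorSpace => p.1.act g p.2 := by
  have h : Continuous fun p : CantorAction H × CantorSpace => p.1.toContinuousMaps g :=
    (continuous_apply g).comp (isClosedEmbedding_toContinuousMaps.continuous.comp continuous_fst)
  exact h.eval continuous_snd

/-- A neighbourhood of an action contains all actions that, for finitely many group elements, act
in the same way up to finitely many coordinates. -/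
theorem exists_agree_of_mem_nhds {β : CantorAction H} {S : Set (CantorAction H)}
    (hS : S ∈ nhds β) : ∃ (E : Finset H) (m : ℕ), ∀ β' : CantorAction H,
      (∀ g ∈ E, ∀ x, ∀ i < m, β'.act g x i = β.act g x i) → β' ∈ S := by
  classical
  -- a finite coordinate agreement is finer than any given entourage, by compactness
  have hV : ∀ V ∈ 𝓤 CantorSpace, ∃ m, ∀ x y : CantorSpace, (∀ i < m, y i = x i) → (x, y) ∈ V := by
    intro V hV
    obtain ⟨m, hm⟩ := exists_subset_nhds_of_compactSpace
      (V := fun m : ℕ => {p : CantorSpace × CantorSpace | ∀ i < m, p.2 i = p.1 i})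
      (directed_of_isDirected_le fun m n hmn p hp i hi => hp i (hi.trans_le hmn))
      (fun m => by
        simp only [Set.ofPred_forall]
        exact isClosed_iInter fun i => isClosed_iInter fun _ => isClosed_eq
          ((continuous_apply i).comp continuous_snd) ((continuous_apply i).comp continuous_fst))
      (U := V) (fun p hp => by
        obtain ⟨x, y⟩ := p
        obtain rfl : y = x := funext fun i => Set.mem_iInter.1 hp (i + 1) i (Nat.lt_succ_self i)
        exact nhds_le_uniformity y hV)
    exact ⟨m, fun x y h => hm (a := (x, y)) h⟩
  rw [isClosedEmbedding_toContinuousMaps.isInducing.nhds_eq_comap, nhds_pi] at hS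
  obtain ⟨T, hT, hTS⟩ := hS
  obtain ⟨I, hI, t, ht, hIt⟩ := Filter.mem_pi.1 hT
  have : ∀ g, ∃ m, ∀ f : C(CantorSpace, CantorSpace),
      (∀ x, ∀ i < m, f x i = β.act g x i) → f ∈ t g := by
    intro g
    obtain ⟨V, hV', hVt⟩ := (nhds_basis_uniformity'
      ContinuousMap.hasBasis_compactConvergenceUniformity_of_compact).mem_iff.1 (ht g)
    obtain ⟨m, hm⟩ := hV V hV'
    exact ⟨m, fun f hf => hVt fun x => hm _ _ (hf x)⟩
  choose m hm using this
  refine ⟨hI.toFinset, hI.toFinset.sup m, fun β' h => hTS (hIt fun g hg => ?_)⟩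
  refine hm g _ fun x i hi => h g (hI.mem_toFinset.2 hg) x i ?_
  exact hi.trans_le (Finset.le_sup (hI.mem_toFinset.2 hg))

/-- The itinerary of a point of the Cantor space with respect to a labelling `f`. The inverse makes
the map to itineraries equivariant for the left shift `(g w) h = w (g⁻¹ * h)`. -/
def itinerary (β : CantorAction H) (f : CantorSpace → σ) (x : CantorSpace) : H → σ :=
  fun h => f (β.act h⁻¹ x)

theorem mulShift_itinerary (β : CantorAction H) (f : CantorSpace → σ) (g : H) (x : CantorSpace) :
    mulShift g (β.itinerary f x) = β.itinerary f (β.act g⁻¹ x) := by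
  funext h
  simp [itinerary, ← act_mul]

/-- Conjugating an action has the same effect on the set of itineraries as changing the labelling;
so along a conjugacy class only countably many subshifts of itineraries occur. -/
theorem range_itinerary_conj (φ : CantorSpace ≃ₜ CantorSpace) (α : CantorAction H)
    (f : CantorSpace → σ) :
    Set.range ((conj φ α).itinerary f) = Set.range (α.itinerary (f ∘ φ)) := by
  have : (conj φ α).itinerary f = α.itinerary (f ∘ φ) ∘ φ.symm := rfl
  rw [this, φ.symm.surjective.range_comp]

variable [TopologicalSpace σ]

theorem continuous_itinerary {f : CantorSpace → σ} (hf : Continuous f) :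
    Continuous fun p : CantorAction H × CantorSpace => p.1.itinerary f p.2 :=
  continuous_pi fun h => hf.comp (continuous_act h⁻¹)

/-- The subshift of all itineraries. -/
def itineraryShift [T2Space σ] (β : CantorAction H) {f : CantorSpace → σ} (hf : Continuous f) :
    MulSubshift σ H where
  carrier := Set.range (β.itinerary f)
  isClosed := (isCompact_range ((continuous_itinerary hf).comp
    (Continuous.prodMk_right β))).isClosed
  mapsTo := by
    rintro g _ ⟨x, rfl⟩
    exact ⟨_, (mulShift_itinerary β f g x).symm⟩

/-- The set of itineraries depends continuously on the action: each inclusion is preserved in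
limits, one because `Y` is closed, the other because the Cantor space is compact. -/
theorem isClosed_range_itinerary_eq [T2Space σ] {f : CantorSpace → σ} (hf : Continuous f)
    {Y : Set (H → σ)} (hY : IsClosed Y) :
    IsClosed {β : CantorAction H | Set.range (β.itinerary f) = Y} := by
  have h1 : IsClosed {β : CantorAction H | Set.range (β.itinerary f) ⊆ Y} := by
    have : {β : CantorAction H | Set.range (β.itinerary f) ⊆ Y} =
        ⋂ x, (fun β : CantorAction H => β.itinerary f x) ⁻¹' Y := by
      ext β; simp [Set.range_subset_iff]
    rw [this]
    exact isClosed_iInter fun x => hY.preimage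
      ((continuous_itinerary hf).comp (Continuous.prodMk_left x))
  have h2 : IsClosed {β : CantorAction H | Y ⊆ Set.range (β.itinerary f)} := by
    have : {β : CantorAction H | Y ⊆ Set.range (β.itinerary f)} =
        ⋂ y ∈ Y, Prod.fst '' {p : CantorAction H × CantorSpace | p.1.itinerary f p.2 = y} := by
      ext β
      simp [Set.subset_def]
    rw [this]
    exact isClosed_biInter fun y _ => isClosedMap_fst_of_compactSpace _
      (isClosed_eq (continuous_itinerary hf) continuous_const)
  convert h1.inter h2 using 1
  ext β
  exact Set.Subset.antisymm_iff

/-- Being of finite type makes `Z` locally maximal: the actions with all itineraries in `Z` form an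
open set, since only the patterns on one finite window have to be controlled. -/
theorem isOpen_range_itinerary_subset [DiscreteTopology σ] {f : CantorSpace → σ}
    (hf : Continuous f) {Z : MulSubshift σ H} (hZ : IsSFT Z) :
    IsOpen {β : CantorAction H | Set.range (β.itinerary f) ⊆ Z.carrier} := by
  obtain ⟨F, allowed, hF⟩ := hZ
  have : {β : CantorAction H | Set.range (β.itinerary f) ⊆ Z.carrier} =
      (Prod.fst '' {p : CantorAction H × CantorSpace |
        (fun i : F => p.1.itinerary f p.2 i) ∈ allowedᶜ})ᶜ := by
    ext β
    simp only [Set.range_subset_iff, hF, mulShift_itinerary]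
    constructor
    · rintro h ⟨⟨β', x⟩, hx, rfl⟩
      refine hx ?_
      have := h x 1
      simpa [act_one] using this
    · intro h x g
      by_contra hg
      exact h ⟨(β, _), hg, rfl⟩
  rw [this]
  refine (isClosedMap_fst_of_compactSpace _ ?_).isOpen_compl
  have hc : Continuous fun p : CantorAction H × CantorSpace =>
      fun i : F => p.1.itinerary f p.2 i :=
    continuous_pi fun i => (continuous_apply _).comp (continuous_itinerary hf)
  exact (isClosed_discrete allowedᶜ).preimage hc

end CantorAction

/-! ### Projectively isolated subshifts from a comeager conjugacy class -/

section

variable {H σ : Type*} [Group H] [TopologicalSpace σ]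

/-- The product of the shift action on a subshift with the trivial action on the Cantor space, in
the convention `(g w) h = w (g⁻¹ * h)`. -/
def SymbolicDynamics.FullShift.MulSubshift.shiftProd (K : MulSubshift σ H) (g : H) :
    (K.carrier × CantorSpace) ≃ₜ (K.carrier × CantorSpace) where
  toFun p := (⟨mulShift g⁻¹ p.1.1, K.mapsTo _ p.1.2⟩, p.2)
  invFun p := (⟨mulShift g p.1.1, K.mapsTo _ p.1.2⟩, p.2)
  left_inv p := by
    refine Prod.ext (Subtype.ext (funext fun h => ?_)) rfl
    simp
  right_inv p := by
    refine Prod.ext (Subtype.ext (funext fun h => ?_)) rfl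
    simp
  continuous_toFun := by
    refine Continuous.prodMk (Continuous.subtype_mk ?_ _) continuous_snd
    exact (continuous_mulShift _).comp (continuous_subtype_val.comp continuous_fst)
  continuous_invFun := by
    refine Continuous.prodMk (Continuous.subtype_mk ?_ _) continuous_snd
    exact (continuous_mulShift _).comp (continuous_subtype_val.comp continuous_fst)

/-- Every subshift in which exactly the labels of the partition `P` occur is the subshift of
itineraries of some action. -/
theorem CantorAction.exists_range_itinerary_eq [Countable H] [Finite σ] [DiscreteTopology σ]
    (K : MulSubshift σ H) {P : CantorSpace → σ} (hP : Continuous P)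
    (hPK : ∀ a, (∃ y, P y = a) ↔ ∃ w ∈ K.carrier, w 1 = a) :
    ∃ β : CantorAction H, Set.range (β.itinerary P) = K.carrier := by
  obtain ⟨Θ, hΘ⟩ := exists_homeomorph_prod_cantorSpace K.isClosed hP hPK
  let β : H →* (CantorSpace ≃ₜ CantorSpace) :=
    { toFun := fun g => (Θ.symm.trans (K.shiftProd g)).trans Θ
      map_one' := by
        refine Homeomorph.ext fun x => ?_
        have : K.shiftProd 1 (Θ.symm x) = Θ.symm x :=
          Prod.ext (Subtype.ext (funext fun h => by simp [MulSubshift.shiftProd])) rfl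
        change Θ (K.shiftProd 1 (Θ.symm x)) = x
        rw [this, Θ.apply_symm_apply]
      map_mul' := fun g g' => by
        refine Homeomorph.ext fun x => ?_
        change Θ (K.shiftProd (g * g') (Θ.symm x)) =
          Θ (K.shiftProd g (Θ.symm (Θ (K.shiftProd g' (Θ.symm x)))))
        rw [Θ.symm_apply_apply]
        congr 1
        refine Prod.ext (Subtype.ext (funext fun h => ?_)) rfl
        simp [MulSubshift.shiftProd, mul_assoc] }
  have hβ : ∀ p, CantorAction.itinerary (H := H) β P (Θ p) = p.1.1 := by
    intro p
    funext h
    change P (Θ (K.shiftProd h⁻¹ (Θ.symm (Θ p)))) = p.1.1 h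
    rw [Θ.symm_apply_apply, hΘ]
    simp [MulSubshift.shiftProd]
  refine ⟨β, Set.Subset.antisymm ?_ fun w hw => ?_⟩
  · rintro _ ⟨x, rfl⟩
    obtain ⟨p, rfl⟩ := Θ.surjective x
    rw [hβ]
    exact p.1.2
  · exact ⟨Θ (⟨w, hw⟩, fun _ => true), hβ _⟩

/-- Each nonempty finite set of letters is the set of labels of some continuous labelling. -/
theorem exists_continuous_cantorSpace_range_eq [Finite σ] [DiscreteTopology σ] (S : Set σ)
    (hS : S.Nonempty) : ∃ f : CantorSpace → σ, Continuous f ∧ ∀ a, (∃ y, f y = a) ↔ a ∈ S := by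
  classical
  have : Nonempty S := hS.to_subtype
  obtain ⟨n, ⟨e⟩⟩ := Finite.exists_equiv_fin S
  have hidx : Function.Injective fun s : S => (e s : ℕ) := Fin.val_injective.comp e.injective
  have hsingle : Function.Injective fun (s t : S) => decide (s = t) := fun s s' h => by
    simpa using congrFun h s'
  -- the coordinates indexed by `S` are read as the indicator function of a point of `S`; words
  -- that are no such indicator function go to an arbitrary point
  let q : (S → Bool) → S := Function.invFun fun (s t : S) => decide (s = t)
  refine ⟨fun x => q fun s => x (e s), ?_, fun a => ⟨?_, fun ha => ?_⟩⟩
  · exact (continuous_of_discreteTopology (f := fun u => (q u : σ))).comp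
      (continuous_pi fun s => continuous_apply _)
  · rintro ⟨y, rfl⟩
    exact (q _).2
  · obtain ⟨u, hu⟩ := Function.invFun_surjective hsingle ⟨a, ha⟩
    obtain ⟨y, rfl⟩ := hidx.surjective_comp_right u
    exact ⟨y, congrArg Subtype.val hu⟩

/-- A continuous labelling by finitely many letters is determined by finitely many clopen sets, and
the Cantor space has only countably many of these. -/
theorem countable_setOf_continuous_cantorSpace [Finite σ] [DiscreteTopology σ] :
    {f : CantorSpace → σ | Continuous f}.Countable := by
  have : Countable (TopologicalSpace.Clopens CantorSpace) :=
    TopologicalSpace.Clopens.countable_iff_secondCountable.2 inferInstance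
  have hinj : Function.Injective fun (f : {f : CantorSpace → σ | Continuous f}) (a : σ) =>
      (⟨f.1 ⁻¹' {a}, (isClopen_discrete {a}).preimage f.2⟩ :
        TopologicalSpace.Clopens CantorSpace) := by
    rintro ⟨f, hf⟩ ⟨g, hg⟩ h
    refine Subtype.ext (funext fun x => ?_)
    have h1 := congrArg TopologicalSpace.Clopens.carrier (congrFun h (f x))
    have : x ∈ g ⁻¹' {f x} := by
      rw [← show f ⁻¹' {f x} = g ⁻¹' {f x} from h1]; rfl
    exact this.symm
  exact Set.countable_coe_iff.1 hinj.countable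

/-- If some conjugacy class is comeager, then in every nonempty open set of actions there is one
whose subshift of itineraries does not change under small perturbations of the action: on the
conjugacy class only countably many subshifts occur, and each occurs on a closed set of actions. -/
theorem HasSTRP.exists_eventually_range_itinerary_eq [Countable H] [Finite σ] [DiscreteTopology σ]
    (h : HasSTRP H) {f : CantorSpace → σ} (hf : Continuous f) {O : Set (CantorAction H)}
    (hO : IsOpen O) (hne : O.Nonempty) :
    ∃ β ∈ O, {β' : CantorAction H | Set.range (β'.itinerary f) = Set.range (β.itinerary f)} ∈
      nhds β := by
  have := CantorAction.baireSpace (H := H)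
  obtain ⟨α, hα⟩ := h
  let 𝒴 : Set (Set (H → σ)) :=
    (fun f => Set.range (α.itinerary f)) '' {f : CantorSpace → σ | Continuous f}
  have h𝒴 : 𝒴.Countable := countable_setOf_continuous_cantorSpace.image _
  have hcl : ∀ Y ∈ 𝒴, IsClosed {β : CantorAction H | Set.range (β.itinerary f) = Y} := by
    rintro _ ⟨f', hf', rfl⟩
    exact CantorAction.isClosed_range_itinerary_eq hf (α.itineraryShift hf').isClosed
  -- off the boundaries of these closed sets, membership is stable under perturbation
  have hres : ⋂ Y ∈ 𝒴, (frontier {β : CantorAction H | Set.range (β.itinerary f) = Y})ᶜ ∈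
      residual (CantorAction H) := by
    refine (countable_bInter_mem h𝒴).2 fun Y hY => ?_
    refine residual_of_dense_open isClosed_frontier.isOpen_compl ?_
    rw [← interior_eq_empty_iff_dense_compl]
    exact interior_frontier (hcl Y hY)
  obtain ⟨β, hβO, hβ, ⟨φ, rfl⟩⟩ :=
    (dense_of_mem_residual (Filter.inter_mem hres hα)).inter_open_nonempty O hO hne
  refine ⟨_, hβO, ?_⟩
  have hY : Set.range ((CantorAction.conj φ α).itinerary f) ∈ 𝒴 := by
    rw [CantorAction.range_itinerary_conj]
    exact ⟨_, hf.comp φ.continuous, rfl⟩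
  have h1 := Set.mem_iInter₂.1 hβ _ hY
  rw [(hcl _ hY).frontier_eq] at h1
  by_contra h2
  exact h1 ⟨rfl, fun h3 => h2 (mem_interior_iff_mem_nhds.1 h3)⟩

/-- Under the strong topological Rokhlin property every nonempty subshift of finite type `Z`
contains a projectively isolated subshift `Y`: there are a subshift of finite type `W` in which
all letters occur and a letter map carrying each subshift of `W` in which all letters occur
onto `Y`. -/
theorem HasSTRP.exists_projectivelyIsolated [Countable H] [Finite σ] [DiscreteTopology σ]
    (h : HasSTRP H) (Z : MulSubshift σ H) (hZne : Z.carrier.Nonempty) (hZ : IsSFT Z) :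
    ∃ (Y : MulSubshift σ H) (k : ℕ) (W : MulSubshift (Fin k) H) (ψ : Fin k → σ),
      Y.carrier ⊆ Z.carrier ∧ Nonempty (Fin k) ∧ IsSFT W ∧ (∀ a, ∃ w ∈ W.carrier, w 1 = a) ∧
      ∀ W' : MulSubshift (Fin k) H, W'.carrier ⊆ W.carrier →
        (∀ a, ∃ w ∈ W'.carrier, w 1 = a) → (ψ ∘ ·) '' W'.carrier = Y.carrier := by
  classical
  -- a labelling `f` of the Cantor space by the letters of `Z`
  obtain ⟨f, hf, hfZ⟩ : ∃ f : CantorSpace → σ, Continuous f ∧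
      ∀ a, (∃ y, f y = a) ↔ ∃ w ∈ Z.carrier, w 1 = a := by
    exact exists_continuous_cantorSpace_range_eq ((fun w : H → σ => w 1) '' Z.carrier)
      (hZne.image _)
  obtain ⟨β₀, hβ₀⟩ := CantorAction.exists_range_itinerary_eq Z hf hfZ
  obtain ⟨β, hβZ, hβ⟩ := h.exists_eventually_range_itinerary_eq hf
    (CantorAction.isOpen_range_itinerary_subset hf hZ) ⟨β₀, hβ₀.le⟩
  obtain ⟨E, m, hE⟩ := CantorAction.exists_agree_of_mem_nhds hβ
  -- the label of `x` records `f x` and, up to the relevant coordinates, `x` and its translates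
  let P₀ : CantorSpace → (Fin m → Bool) × (E → Fin m → Bool) × σ := fun x =>
    (fun i => x i, fun g i => β.act g x i, f x)
  have hP₀ : Continuous P₀ := by
    refine Continuous.prodMk (continuous_pi fun i => continuous_apply _)
      (Continuous.prodMk (continuous_pi fun g => continuous_pi fun i => ?_) hf)
    exact (continuous_apply _).comp (β.act g).continuous
  obtain ⟨k, ⟨e⟩⟩ := Finite.exists_equiv_fin (Set.range P₀)
  let P : CantorSpace → Fin k := fun x => e ⟨P₀ x, x, rfl⟩
  have hP : Continuous P :=
    (continuous_of_discreteTopology (f := e)).comp (Continuous.subtype_mk hP₀ _)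
  have hPsurj : Function.Surjective P := fun a => by
    obtain ⟨x, hx⟩ := (e.symm a).2
    exact ⟨x, by simp [P, hx]⟩
  let r : Fin k → (Fin m → Bool) × (E → Fin m → Bool) × σ := fun a => (e.symm a).1
  have hr : ∀ x, r (P x) = P₀ x := fun x => by simp [r, P]
  -- the recorded translates are the true ones; by `hitin` below this means that the action
  -- agrees with `β` in the sense of `hE`
  let W : MulSubshift (Fin k) H :=
    { carrier := {w | ∀ h : H, ∀ g : E, (r (w (h * (g : H)⁻¹))).1 = (r (w h)).2.1 g}
      isClosed := by
        simp only [Set.ofPred_forall]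
        refine isClosed_iInter fun h => isClosed_iInter fun g => isClosed_eq ?_ ?_
        · exact (continuous_of_discreteTopology (f := fun a => (r a).1)).comp (continuous_apply _)
        · exact (continuous_of_discreteTopology (f := fun a => (r a).2.1 g)).comp
            (continuous_apply _)
      mapsTo := fun g₀ w hw h g => by
        have := hw (g₀ * h) g
        simpa [mul_assoc] using this }
  have hW : IsSFT W := by
    refine ⟨insert 1 (E.image fun g => g⁻¹), {p | ∀ (g : E) (h1 : (1 : H) ∈ _) (hg : (g : H)⁻¹ ∈ _),
      (r (p ⟨(g : H)⁻¹, hg⟩)).1 = (r (p ⟨1, h1⟩)).2.1 g}, fun w => ?_⟩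
    constructor
    · intro hw h g h1 hg
      simpa using hw h g
    · intro hw h g
      have := hw h g (by simp) (by simp)
      simpa using this
  have hitin : ∀ β' : CantorAction H, Set.range (β'.itinerary P) ⊆ W.carrier ↔
      ∀ g ∈ E, ∀ x, ∀ i < m, β'.act g x i = β.act g x i := by
    intro β'
    constructor
    · intro hβ' g hg x i hi
      have h1 : (r (β'.itinerary P x (1 * g⁻¹))).1 = (r (β'.itinerary P x 1)).2.1 ⟨g, hg⟩ :=
        hβ' ⟨x, rfl⟩ 1 ⟨g, hg⟩
      simp only [CantorAction.itinerary, hr, one_mul, inv_inv, inv_one,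
        CantorAction.act_one] at h1
      exact congrFun h1 ⟨i, hi⟩
    · rintro hβ' _ ⟨x, rfl⟩ h g
      simp only [CantorAction.itinerary, hr, mul_inv_rev, inv_inv, CantorAction.act_mul]
      exact funext fun i => hβ' g g.2 _ i i.2
  refine ⟨β.itineraryShift hf, k, W, fun a => (r a).2.2, hβZ, ⟨P fun _ => true⟩, hW, fun a => ?_,
    fun W' hW' hall => ?_⟩
  · obtain ⟨x, hx⟩ := hPsurj a
    refine ⟨β.itinerary P x, (hitin β).2 (fun _ _ _ _ _ => rfl) ⟨x, rfl⟩, ?_⟩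
    simp [CantorAction.itinerary, CantorAction.act_one, hx]
  · obtain ⟨β', hβ'⟩ := CantorAction.exists_range_itinerary_eq W' hP
      fun a => ⟨fun _ => hall a, fun _ => hPsurj a⟩
    have h1 : Set.range (β'.itinerary f) = Set.range (β.itinerary f) :=
      hE β' ((hitin β').1 (hβ'.trans_subset hW'))
    rw [← hβ', ← Set.range_comp]
    refine Eq.trans ?_ h1
    congr 1
    funext x h
    simp [CantorAction.itinerary, hr, P₀]

end

/-! ### Recursively enumerable predicates and compactness -/

namespace REPred

variable {α β : Type*} [Primcodable α] [Primcodable β]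

/-- A recursively enumerable predicate holds iff it is confirmed at some stage of a primitive
recursive enumeration. -/
theorem exists_primrecRel {p : α → Prop} (hp : REPred p) :
    ∃ R : α → ℕ → Prop, PrimrecRel R ∧ ∀ a, p a ↔ ∃ n, R a n := by
  obtain ⟨c, hc⟩ := Nat.Partrec.Code.exists_code.1 hp
  refine ⟨fun a n => (c.evaln n (Encodable.encode a)).isSome = true, ?_, fun a => ?_⟩
  · have : Primrec fun x : α × ℕ => (c.evaln x.2 (Encodable.encode x.1)).isSome :=
      Primrec.option_isSome.comp (Nat.Partrec.Code.primrec_evaln.comp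
        (Primrec.pair (Primrec.pair Primrec.snd (Primrec.const c))
          (Primrec.encode.comp Primrec.fst)))
    exact Primrec.eq.comp this (Primrec.const true)
  · have h1 : p a ↔ (c.eval (Encodable.encode a)).Dom := by
      rw [hc]; simp [Part.assert, Part.map]
    rw [h1, Part.dom_iff_mem]
    constructor
    · rintro ⟨y, hy⟩
      obtain ⟨n, hn⟩ := Nat.Partrec.Code.evaln_complete.1 hy
      exact ⟨n, Option.isSome_iff_exists.2 ⟨y, hn⟩⟩
    · rintro ⟨n, hn⟩
      obtain ⟨y, hy⟩ := Option.isSome_iff_exists.1 hn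
      exact ⟨y, Nat.Partrec.Code.evaln_sound hy⟩

theorem exists_nat {R : α → ℕ → Prop} (hR : PrimrecRel R) : REPred fun a => ∃ n, R a n := by
  classical
  have : Partrec fun a => Nat.rfind fun n => Part.some (decide (R a n)) :=
    Partrec.rfind (Primrec.to_comp hR.decide).partrec
  refine this.dom_re.of_eq fun a => ?_
  refine Nat.rfind_dom.trans ?_
  simp

theorem of_primrecPred {p : α → Prop} (hp : PrimrecPred p) : REPred p :=
  hp.computablePred.to_re

theorem comp {p : β → Prop} (hp : REPred p) {f : α → β} (hf : Primrec f) :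
    REPred fun a => p (f a) := by
  obtain ⟨R, hR, h⟩ := hp.exists_primrecRel
  refine (exists_nat (R := fun a n => R (f a) n) ?_).of_eq fun a => (h _).symm
  exact hR.comp (hf.comp Primrec.fst) Primrec.snd

theorem exists_snd {p : α → β → Prop} (hp : REPred fun x : α × β => p x.1 x.2) :
    REPred fun a => ∃ b, p a b := by
  obtain ⟨R, hR, h⟩ := hp.exists_primrecRel
  have hS : PrimrecRel fun (a : α) (n : ℕ) =>
      ∃ b ∈ (Encodable.decode (α := β) n.unpair.1).toList, R (a, b) n.unpair.2 := by
    have h1 : PrimrecRel fun (b : β) (x : α × ℕ) => R (x.1, b) x.2 :=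
      hR.comp (Primrec.pair (Primrec.fst.comp Primrec.snd) Primrec.fst)
        (Primrec.snd.comp Primrec.snd)
    refine h1.exists_mem_list.comp (f := fun x : α × ℕ =>
      (Encodable.decode (α := β) x.2.unpair.1).toList) (g := fun x : α × ℕ =>
        (x.1, x.2.unpair.2)) ?_ ?_
    · exact Primrec.optionToList.comp
        (Primrec.decode.comp (Primrec.fst.comp (Primrec.unpair.comp Primrec.snd)))
    · exact Primrec.pair Primrec.fst (Primrec.snd.comp (Primrec.unpair.comp Primrec.snd))
  refine (exists_nat hS).of_eq fun a => ?_
  constructor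
  · rintro ⟨n, b, -, hb⟩
    exact ⟨b, (h (a, b)).2 ⟨_, hb⟩⟩
  · rintro ⟨b, hb⟩
    obtain ⟨m, hm⟩ := (h (a, b)).1 hb
    exact ⟨Nat.pair (Encodable.encode b) m, b, by simp, by simpa using hm⟩

theorem and {p q : α → Prop} (hp : REPred p) (hq : REPred q) : REPred fun a => p a ∧ q a := by
  obtain ⟨R, hR, h⟩ := hp.exists_primrecRel
  obtain ⟨S, hS, h'⟩ := hq.exists_primrecRel
  have : PrimrecRel fun (a : α) (n : ℕ) => R a n.unpair.1 ∧ S a n.unpair.2 :=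
    (hR.comp Primrec.fst (Primrec.fst.comp (Primrec.unpair.comp Primrec.snd))).and
      (hS.comp Primrec.fst (Primrec.snd.comp (Primrec.unpair.comp Primrec.snd)))
  refine (exists_nat this).of_eq fun a => ?_
  rw [h, h']
  constructor
  · rintro ⟨n, h1, h2⟩
    exact ⟨⟨_, h1⟩, ⟨_, h2⟩⟩
  · rintro ⟨⟨m, h1⟩, ⟨n, h2⟩⟩
    exact ⟨Nat.pair m n, by simpa using h1, by simpa using h2⟩

theorem or {p q : α → Prop} (hp : REPred p) (hq : REPred q) : REPred fun a => p a ∨ q a := by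
  obtain ⟨R, hR, h⟩ := hp.exists_primrecRel
  obtain ⟨S, hS, h'⟩ := hq.exists_primrecRel
  have : PrimrecRel fun (a : α) (n : ℕ) => R a n ∨ S a n := PrimrecPred.or hR hS
  refine (exists_nat this).of_eq fun a => ?_
  rw [h, h', exists_or]

theorem forall_mem_list {p : β → α → Prop} (hp : REPred fun x : β × α => p x.1 x.2) :
    REPred fun x : List β × α => ∀ b ∈ x.1, p b x.2 := by
  obtain ⟨R, hR, h⟩ := hp.exists_primrecRel
  -- a common bound for the stages at which the finitely many instances are confirmed
  have h1 : PrimrecRel fun (n : ℕ) (y : β × α) => R y n := hR.comp Primrec.snd Primrec.fst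
  have h2 : PrimrecRel fun (b : β) (y : α × ℕ) => ∃ n ∈ List.range y.2, R (b, y.1) n :=
    h1.exists_mem_list.comp (f := fun z : β × α × ℕ => List.range z.2.2)
      (g := fun z : β × α × ℕ => (z.1, z.2.1))
      (Primrec.list_range.comp (Primrec.snd.comp Primrec.snd))
      (Primrec.pair Primrec.fst (Primrec.fst.comp Primrec.snd))
  have hS : PrimrecRel fun (x : List β × α) (N : ℕ) =>
      ∀ b ∈ x.1, ∃ n ∈ List.range N, R (b, x.2) n :=
    h2.forall_mem_list.comp (f := fun z : (List β × α) × ℕ => z.1.1)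
      (g := fun z : (List β × α) × ℕ => (z.1.2, z.2)) (Primrec.fst.comp Primrec.fst)
      (Primrec.pair (Primrec.snd.comp Primrec.fst) Primrec.snd)
  refine (exists_nat hS).of_eq fun ⟨l, a⟩ => ?_
  constructor
  · rintro ⟨N, hN⟩ b hb
    obtain ⟨n, -, hn⟩ := hN b hb
    exact (h (b, a)).2 ⟨n, hn⟩
  · intro hl
    have : ∃ N, ∀ b ∈ l, ∃ n ∈ List.range N, R (b, a) n := by
      induction l with
      | nil => exact ⟨0, by simp⟩
      | cons b l ih =>
        obtain ⟨N, hN⟩ := ih fun c hc => hl c (List.mem_cons_of_mem _ hc)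
        obtain ⟨n, hn⟩ := (h (b, a)).1 (hl b List.mem_cons_self)
        refine ⟨max N (n + 1), fun c hc => ?_⟩
        rcases List.mem_cons.1 hc with rfl | hc
        · exact ⟨n, List.mem_range.2 (by omega), hn⟩
        · obtain ⟨m, hm, hm'⟩ := hN c hc
          exact ⟨m, List.mem_range.2 (by have := List.mem_range.1 hm; omega), hm'⟩
    exact this

end REPred

/-- All lists of length `M` over a given list of letters. -/
def allLists {σ : Type*} (letters : List σ) : ℕ → List (List σ)
  | 0 => [[]]
  | M + 1 => (allLists letters M).flatMap fun τ => letters.map fun a => a :: τ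

theorem mem_allLists {σ : Type*} {letters : List σ} (h : ∀ a, a ∈ letters) :
    ∀ {M : ℕ} {τ : List σ}, τ ∈ allLists letters M ↔ τ.length = M
  | 0, τ => by simp [allLists]
  | M + 1, τ => by
    cases τ with
    | nil => simp [allLists]
    | cons a τ => simp [allLists, mem_allLists h (M := M), h]

theorem primrec_allLists {σ : Type*} [Primcodable σ] (letters : List σ) :
    Primrec (allLists letters) := by
  have : Primrec fun M : ℕ => Nat.rec (motive := fun _ => List (List σ)) [[]]
      (fun _ l => l.flatMap fun τ => letters.map fun a => a :: τ) M := by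
    refine Primrec.nat_rec₁ _ ?_
    have h1 : Primrec₂ fun (τ : List σ) (a : σ) => a :: τ :=
      Primrec.list_cons.comp Primrec.snd Primrec.fst
    have h2 : Primrec fun τ : List σ => letters.map fun a => a :: τ :=
      Primrec.list_map (Primrec.const _) h1
    exact Primrec.list_flatMap (g := fun _ τ => letters.map fun a => a :: τ) Primrec.snd
      (h2.comp Primrec.snd)
  refine this.of_eq fun M => ?_
  induction M with
  | zero => rfl
  | succ M ih => simp only [allLists, ← ih]

/-- `z` agrees with the finite pattern `q`, a list of pairs (position, letter). -/
def Matches {ι σ : Type*} (z : ι → σ) (q : List (ι × σ)) : Prop :=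
  ∀ x ∈ q, z x.1 = x.2

theorem isOpen_setOf_forall_mem_list {ι σ γ : Type*} [TopologicalSpace σ] [DiscreteTopology σ]
    (c : List γ) (t : γ → ι) (P : γ → σ → Prop) :
    IsOpen {z : ι → σ | ∀ x ∈ c, P x (z (t x))} := by
  have : {z : ι → σ | ∀ x ∈ c, P x (z (t x))} =
      ⋂ x ∈ {x | x ∈ c}, (fun z : ι → σ => z (t x)) ⁻¹' {a | P x a} := by
    ext z; simp
  rw [this]
  exact (List.finite_toSet c).isOpen_biInter fun x _ =>
    (isOpen_discrete _).preimage (continuous_apply (t x))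

/-- Emptiness of the set of configurations avoiding a recursively enumerable family of finite
patterns is semidecidable: by compactness there is then a finite length `M` such that each
assignment of the first `M` positions already contains a forbidden pattern. -/
theorem REPred.not_exists_avoiding {α ι : Type*} [Primcodable α] [Primcodable ι] {k : ℕ}
    [Nonempty (Fin k)]
    {Q : α → List (ι × Fin k) → Prop} (hQ : REPred fun x : α × List (ι × Fin k) => Q x.1 x.2) :
    REPred fun a => ¬ ∃ z : ι → Fin k, ∀ q, Q a q → ¬ Matches z q := by
  have hF : PrimrecRel fun (q : List (ι × Fin k)) (τ : List (Fin k)) =>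
      ∀ x ∈ q, τ[Encodable.encode x.1]? = some x.2 := by
    refine PrimrecRel.forall_mem_list (R := fun (x : ι × Fin k) (τ : List (Fin k)) =>
      τ[Encodable.encode x.1]? = some x.2) ?_
    exact Primrec.eq.comp (Primrec.list_getElem?.comp Primrec.snd
      (Primrec.encode.comp (Primrec.fst.comp Primrec.fst)))
      (Primrec.option_some.comp (Primrec.snd.comp Primrec.fst))
  have h1 : REPred fun x : List (Fin k) × α => ∃ q, Q x.2 q ∧
      ∀ y ∈ q, x.1[Encodable.encode y.1]? = some y.2 := by
    refine REPred.exists_snd (p := fun (x : List (Fin k) × α) q => Q x.2 q ∧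
      ∀ y ∈ q, x.1[Encodable.encode y.1]? = some y.2) (REPred.and ?_ ?_)
    · exact hQ.comp (Primrec.pair (Primrec.snd.comp Primrec.fst) Primrec.snd)
    · exact REPred.of_primrecPred (hF.comp Primrec.snd (Primrec.fst.comp Primrec.fst))
  have h2 := (REPred.forall_mem_list (p := fun (τ : List (Fin k)) (a : α) => ∃ q, Q a q ∧
      ∀ y ∈ q, τ[Encodable.encode y.1]? = some y.2) h1).comp
    (f := fun x : α × ℕ => (allLists (List.finRange k) x.2, x.1))
    (Primrec.pair ((primrec_allLists _).comp Primrec.snd) Primrec.fst)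
  refine (REPred.exists_snd (p := fun (a : α) (M : ℕ) => ∀ τ ∈ allLists (List.finRange k) M,
    ∃ q, Q a q ∧ ∀ y ∈ q, τ[Encodable.encode y.1]? = some y.2) h2).of_eq fun a => ?_
  simp only [mem_allLists List.mem_finRange]
  constructor
  · rintro ⟨M, hM⟩ ⟨z, hz⟩
    obtain ⟨q, hq, hq'⟩ := hM ((List.range M).map fun i =>
      ((Encodable.decode i : Option ι).map z).getD (Classical.arbitrary _)) (by simp)
    refine hz q hq fun y hy => ?_
    have := hq' y hy
    simp only [List.getElem?_map, Option.map_eq_some_iff] at this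
    obtain ⟨i, hi, hi'⟩ := this
    obtain ⟨hlt, rfl⟩ := List.getElem?_eq_some_iff.1 hi
    simpa using hi'
  · intro h
    let U : ℕ → Set (ι → Fin k) := fun M =>
      {z | ∃ q, Q a q ∧ (∀ y ∈ q, Encodable.encode y.1 < M) ∧ Matches z q}
    have hU : ∀ M, IsOpen (U M) := fun M => by
      have : U M = ⋃ q ∈ {q | Q a q ∧ ∀ y ∈ q, Encodable.encode y.1 < M},
          {z : ι → Fin k | ∀ y ∈ q, z y.1 = y.2} := by
        ext z; simp [U, Matches, and_assoc]
      rw [this]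
      exact isOpen_biUnion fun q _ =>
        isOpen_setOf_forall_mem_list q Prod.fst fun y b => b = y.2
    have hmono : Monotone U := fun M N hMN z ⟨q, h1, h2, h3⟩ =>
      ⟨q, h1, fun y hy => (h2 y hy).trans_le hMN, h3⟩
    obtain ⟨M, hM⟩ := isCompact_univ.elim_directed_cover U hU (fun z _ => by
      by_contra hz
      refine h ⟨z, fun q hq hzq => hz (Set.mem_iUnion.2 ?_)⟩
      have : ∃ M, ∀ y ∈ q, Encodable.encode y.1 < M := by
        clear hzq hq
        induction q with
        | nil => exact ⟨0, by simp⟩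
        | cons x q ih =>
          obtain ⟨N, hN⟩ := ih
          refine ⟨max N (Encodable.encode x.1 + 1), fun y hy => ?_⟩
          rcases List.mem_cons.1 hy with rfl | hy
          · omega
          · have := hN y hy; omega
      exact this.imp fun M hM => ⟨q, hq, hM, hzq⟩) hmono.directed_le
    refine ⟨M, fun τ hτ => ?_⟩
    obtain ⟨q, hq, h1, h2⟩ := hM (Set.mem_univ fun u =>
      τ.getD (Encodable.encode u) (Classical.arbitrary _))
    refine ⟨q, hq, fun y hy => ?_⟩
    have h3 := h1 y hy
    rw [← h2 y hy]
    simp [List.getElem?_eq_getElem (hτ ▸ h3)]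

/-! ### Recursively presented groups and decidable languages -/

/-- A function on words factors through the group presented by `R` as soon as it is unaffected by
deleting cancelling pairs and relators inside words: the elements that may be deleted anywhere form
a normal subgroup containing the relators. -/
theorem FreeGroup.exists_factor_of_mem_normalClosure {ι σ : Type*}
    {H : Type*} [Group H] (π : FreeGroup ι →* H) (hπ : Function.Surjective π)
    {R : Set (List (ι × Bool))}
    (hR : Subgroup.normalClosure (FreeGroup.mk '' R) = π.ker)
    (z : List (ι × Bool) → σ)
    (hcancel : ∀ u v i b, z (u ++ (i, b) :: (i, !b) :: v) = z (u ++ v))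
    (hrel : ∀ r ∈ R, ∀ u v, z (u ++ r ++ v) = z (u ++ v)) :
    ∃ w : H → σ, ∀ u, z u = w (π (FreeGroup.mk u)) := by
  let z' : FreeGroup ι → σ := Quot.lift z (by
    rintro _ _ ⟨⟩
    exact hcancel _ _ _ _)
  have hz' : ∀ u, z' (FreeGroup.mk u) = z u := fun _ => rfl
  -- the elements that may be inserted anywhere without changing `z'`
  let K : Subgroup (FreeGroup ι) :=
    { carrier := {k | ∀ a b, z' (a * k * b) = z' (a * b)}
      one_mem' := fun a b => by simp
      mul_mem' := fun {k l} hk hl a b => by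
        have := hl (a * k) b
        rw [hk a b] at this
        rw [← this]; simp only [mul_assoc]
      inv_mem' := fun {k} hk a b => by
        have := hk (a * k⁻¹) b
        rw [← this]; simp }
  have hKn : K.Normal := ⟨fun k hk g a b => by
    have := hk (a * g) (g⁻¹ * b)
    simp only [mul_assoc, mul_inv_cancel_left] at this ⊢
    exact this⟩
  have hle : π.ker ≤ K := by
    rw [← hR]
    refine Subgroup.normalClosure_le_normal ?_
    rintro _ ⟨r, hr, rfl⟩ a b
    induction a using Quot.ind with | _ a
    induction b using Quot.ind with | _ b
    exact hrel r hr a b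
  refine ⟨fun h => z' (Function.surjInv hπ h), fun u => ?_⟩
  have h1 : π (FreeGroup.mk u) = π (Function.surjInv hπ (π (FreeGroup.mk u))) :=
    (Function.surjInv_eq hπ _).symm
  have h2 : (Function.surjInv hπ (π (FreeGroup.mk u)))⁻¹ * FreeGroup.mk u ∈ K :=
    hle (by rw [MonoidHom.mem_ker, _root_.map_mul, _root_.map_inv, ← h1]; simp)
  have := h2 (Function.surjInv hπ (π (FreeGroup.mk u))) 1
  simpa [hz'] using this

/-- A recursively presented group has a monoid presentation: a finite symmetric generating family
`s` and a recursively enumerable set `R` of words, such that a function on words is a function of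
the represented group element as soon as it is unaffected by deleting words of `R`. -/
theorem IsFGRecursivelyPresented.exists_wordRelators {H : Type*} [Group H]
    (h : IsFGRecursivelyPresented H) :
    ∃ (m : ℕ) (s : Fin m → H) (R : Set (List (Fin m))),
      (∀ i, ∃ j, s j = (s i)⁻¹) ∧ (∀ g, ∃ u : List (Fin m), (u.map s).prod = g) ∧
      REPred (fun r => r ∈ R) ∧ (∀ r ∈ R, (r.map s).prod = 1) ∧
      ∀ (k : ℕ) (z : List (Fin m) → Fin k),
        (∀ r ∈ R, ∀ u v, z (u ++ r ++ v) = z (u ++ v)) →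
        ∃ w : H → Fin k, ∀ u, z u = w (u.map s).prod := by
  obtain ⟨n, π, R, hπ, hR, hker⟩ := h
  obtain ⟨m, ⟨ε⟩⟩ := Finite.exists_equiv_fin (Fin n × Bool)
  let s : Fin m → H := fun i => π (FreeGroup.mk [ε.symm i])
  have hs : ∀ u : List (Fin m), (u.map s).prod = π (FreeGroup.mk (u.map ε.symm)) := by
    intro u
    induction u with
    | nil => simp [← FreeGroup.one_eq_mk]
    | cons i u ih =>
      rw [List.map_cons, List.prod_cons, ih, ← map_mul, FreeGroup.mul_mk]
      rfl
  refine ⟨m, s, {r | r.map ε.symm ∈ R ∨ ∃ x : Fin n × Bool, r.map ε.symm = [x, (x.1, !x.2)]},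
    fun i => ⟨ε ((ε.symm i).1, !(ε.symm i).2), ?_⟩, fun g => ?_, ?_, ?_, fun k z hz => ?_⟩
  · simp [s, ← map_inv, FreeGroup.inv_mk, FreeGroup.invRev]
  · obtain ⟨x, rfl⟩ := hπ g
    refine ⟨x.toWord.map ε, ?_⟩
    rw [hs]; simp [Function.comp_def, FreeGroup.mk_toWord]
  · have hmap : Primrec fun r : List (Fin m) => r.map ε.symm :=
      Primrec.list_map Primrec.id ((Primrec.dom_finite ε.symm).comp Primrec.snd)
    refine (hR.comp hmap).or (REPred.exists_snd
      (p := fun (r : List (Fin m)) (x : Fin n × Bool) => r.map ε.symm = [x, (x.1, !x.2)])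
      (REPred.of_primrecPred ?_))
    have h2 : Primrec fun x : Fin n × Bool => [x, (x.1, !x.2)] := Primrec.dom_finite _
    exact Primrec.eq.comp (hmap.comp Primrec.fst) (h2.comp Primrec.snd)
  · rintro r (hr | ⟨x, hr⟩)
    · rw [hs]
      have : FreeGroup.mk (r.map ε.symm) ∈ π.ker :=
        hker ▸ Subgroup.subset_normalClosure ⟨_, hr, rfl⟩
      exact this
    · rw [hs, hr]
      have : FreeGroup.mk [x, (x.1, !x.2)] = 1 := by
        rw [FreeGroup.one_eq_mk]
        exact Quot.sound (FreeGroup.Red.Step.not (L₁ := []) (L₂ := []))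
      rw [this, map_one]
  · have hmm : ∀ r : List (Fin n × Bool), (r.map ε).map ε.symm = r := fun r => by
      simp [Function.comp_def]
    obtain ⟨w, hw⟩ := FreeGroup.exists_factor_of_mem_normalClosure π hπ hker
      (fun u => z (u.map ε)) (fun u v i b => by
        have := hz ([(i, b), (i, !b)].map ε) (Or.inr ⟨(i, b), hmm _⟩) (u.map ε) (v.map ε)
        simpa using this) (fun r hr u v => by
        have := hz (r.map ε) (Or.inl (by rw [hmm]; exact hr)) (u.map ε) (v.map ε)
        simpa using this)
    refine ⟨w, fun u => ?_⟩
    rw [hs, ← hw]; simp [Function.comp_def]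

/-- The configurations of a subshift of finite type, read as functions on words, are defined by a
recursively enumerable family of forbidden patterns: the translates of the finitely many forbidden
patterns on the window, and the patterns with different letters at two words one of which arises
from the other by deleting a relator. -/
theorem IsSFT.exists_rePred_forbidden {H : Type*} [Group H] {m k : ℕ} {s : Fin m → H}
    {R : Set (List (Fin m))} (hsurj : ∀ g, ∃ u : List (Fin m), (u.map s).prod = g)
    (hRre : REPred (fun r => r ∈ R)) (hR1 : ∀ r ∈ R, (r.map s).prod = 1)
    (hR : ∀ z : List (Fin m) → Fin k, (∀ r ∈ R, ∀ u v, z (u ++ r ++ v) = z (u ++ v)) →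
        ∃ w : H → Fin k, ∀ u, z u = w (u.map s).prod)
    {W : MulSubshift (Fin k) H} (hW : IsSFT W) :
    ∃ Q : List (List (Fin m) × Fin k) → Prop, REPred Q ∧
      ∀ z : List (Fin m) → Fin k, (∀ q, Q q → ¬ Matches z q) ↔
        ∃ w ∈ W.carrier, ∀ u, z u = w (u.map s).prod := by
  classical
  obtain ⟨F, allowed, hF⟩ := hW
  choose word hword using hsurj
  let code : (F → Fin k) → List (List (Fin m) × Fin k) := fun p =>
    (Finset.univ : Finset F).toList.map fun f : F => (word f, p f)
  let L : List (List (List (Fin m) × Fin k)) :=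
    ((Finset.univ.filter fun p : F → Fin k => p ∉ allowed).toList).map code
  refine ⟨fun q => (∃ x : (List (Fin m) × List (Fin m) × List (Fin m)) × Fin k × Fin k,
      x.1.2.1 ∈ R ∧ x.2.1 ≠ x.2.2 ∧
        q = [(x.1.1 ++ x.1.2.1 ++ x.1.2.2, x.2.1), (x.1.1 ++ x.1.2.2, x.2.2)]) ∨
      ∃ g : List (Fin m), ∃ q₀ ∈ L, q = q₀.map fun x => (g ++ x.1, x.2), ?_, fun z => ?_⟩
  · refine REPred.or (REPred.exists_snd (REPred.and ?_ (REPred.and ?_ ?_))) (REPred.exists_snd ?_)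
    · exact hRre.comp (Primrec.fst.comp (Primrec.snd.comp (Primrec.fst.comp Primrec.snd)))
    · refine REPred.of_primrecPred (PrimrecPred.not (Primrec.eq.comp
        (Primrec.fst.comp (Primrec.snd.comp Primrec.snd))
        (Primrec.snd.comp (Primrec.snd.comp Primrec.snd))))
    · refine REPred.of_primrecPred (Primrec.eq.comp Primrec.fst ?_)
      have hx : Primrec fun x : (List (Fin m) × List (Fin m) × List (Fin m)) × Fin k × Fin k =>
          [(x.1.1 ++ x.1.2.1 ++ x.1.2.2, x.2.1), (x.1.1 ++ x.1.2.2, x.2.2)] := by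
        have h1 : Primrec fun x : (List (Fin m) × List (Fin m) × List (Fin m)) × Fin k × Fin k =>
            x.1.1 := Primrec.fst.comp Primrec.fst
        have h2 : Primrec fun x : (List (Fin m) × List (Fin m) × List (Fin m)) × Fin k × Fin k =>
            x.1.2.1 := Primrec.fst.comp (Primrec.snd.comp Primrec.fst)
        have h3 : Primrec fun x : (List (Fin m) × List (Fin m) × List (Fin m)) × Fin k × Fin k =>
            x.1.2.2 := Primrec.snd.comp (Primrec.snd.comp Primrec.fst)
        exact Primrec.list_cons.comp (Primrec.pair (Primrec.list_append.comp
          (Primrec.list_append.comp h1 h2) h3) (Primrec.fst.comp Primrec.snd))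
          (Primrec.list_cons.comp (Primrec.pair (Primrec.list_append.comp h1 h3)
            (Primrec.snd.comp Primrec.snd)) (Primrec.const []))
      exact hx.comp Primrec.snd
    · have h1 : PrimrecRel fun (q₀ : List (List (Fin m) × Fin k))
          (y : List (List (Fin m) × Fin k) × List (Fin m)) =>
            y.1 = q₀.map fun x => (y.2 ++ x.1, x.2) := by
        refine Primrec.eq.comp (Primrec.fst.comp Primrec.snd) (Primrec.list_map Primrec.fst ?_)
        exact Primrec.pair (Primrec.list_append.comp
          (Primrec.snd.comp (Primrec.snd.comp Primrec.fst)) (Primrec.fst.comp Primrec.snd))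
          (Primrec.snd.comp Primrec.snd)
      exact REPred.of_primrecPred (h1.exists_mem_list.comp (Primrec.const L) Primrec.id)
  · constructor
    · intro hz
      obtain ⟨w, hw⟩ := hR z fun r hr u v => by
        by_contra hne
        refine hz _ (Or.inl ⟨((u, r, v), z (u ++ r ++ v), z (u ++ v)), hr, hne, rfl⟩) ?_
        simp [Matches]
      refine ⟨w, (hF w).2 fun g => ?_, hw⟩
      by_contra hg
      refine hz _ (Or.inr ⟨word g, code fun f => mulShift g w f,
        List.mem_map.2 ⟨_, ?_, rfl⟩, rfl⟩) ?_
      · simpa using hg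
      · simp [Matches, code, hw, hword]
    · rintro ⟨w, hwW, hw⟩ q (⟨⟨⟨u, r, v⟩, a, a'⟩, hr, hne, rfl⟩ | ⟨g, q₀, hq₀, rfl⟩) hq
      · have h1 := hq _ List.mem_cons_self
        have h2 := hq _ (List.mem_cons_of_mem _ List.mem_cons_self)
        simp only [hw] at h1 h2
        refine hne ?_
        rw [← h1, ← h2]
        simp [hR1 r hr]
      · obtain ⟨p, hp, rfl⟩ := List.mem_map.1 hq₀
        have hp' : p ∉ allowed := by simpa using hp
        refine hp' ?_
        convert (hF w).1 hwW ((g.map s).prod) using 1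
        funext f
        have := hq (g ++ word f, p f) (List.mem_map.2
          ⟨(word f, p f), List.mem_map.2 ⟨f, by simp, rfl⟩, rfl⟩)
        rw [hw, List.map_append, List.prod_append, hword] at this
        exact this.symm

/-- The occurrence of finite patterns in a projectively isolated subshift `Y` is decidable. A
pattern does not occur iff no configuration of `W` is mapped to one showing it. It does occur iff,
for some letter, no configuration of `W` with this letter at the identity has an image in which all
translates of the pattern are absent: otherwise these configurations would form a subshift of `W`
containing all letters, which is mapped onto `Y`. Both conditions are instances of
`REPred.not_exists_avoiding`. The input may be any list of words with letters; a list giving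
different letters to two words for the same position matches no configuration. -/
theorem exists_computable_of_projectivelyIsolated {H B : Type*} [Group H] [TopologicalSpace B]
    [DiscreteTopology B] {k kB : ℕ} (hH : IsFGRecursivelyPresented H) (e : B ≃ Fin kB)
    (Y : MulSubshift B H) (W : MulSubshift (Fin k) H) (hW : IsSFT W) (ψ : Fin k → B)
    [Nonempty (Fin k)] (hall : ∀ a, ∃ w ∈ W.carrier, w 1 = a)
    (hiso : ∀ W' : MulSubshift (Fin k) H, W'.carrier ⊆ W.carrier →
      (∀ a, ∃ w ∈ W'.carrier, w 1 = a) → (ψ ∘ ·) '' W'.carrier = Y.carrier) :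
    ∃ (m : ℕ) (s : Fin m → H), (∀ i, ∃ j, s j = (s i)⁻¹) ∧
      (∀ g, ∃ u : List (Fin m), (u.map s).prod = g) ∧
      ∃ alg : List (List (Fin m) × Fin kB) → Bool, Computable alg ∧
        ∀ c, alg c = true ↔ ∃ y ∈ Y.carrier, ∀ x ∈ c, e (y (x.1.map s).prod) = x.2 := by
  classical
  obtain ⟨m, s, R, hsymm, hsurj, hRre, hR1, hR⟩ := hH.exists_wordRelators
  obtain ⟨Q, hQre, hQ⟩ := hW.exists_rePred_forbidden hsurj hRre hR1 (hR k)
  have hWY : (ψ ∘ ·) '' W.carrier = Y.carrier := hiso W subset_rfl hall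
  refine ⟨m, s, hsymm, hsurj, fun c => decide (∃ y ∈ Y.carrier, ∀ x ∈ c,
    e (y (x.1.map s).prod) = x.2), ?_, fun c => by simp⟩
  rw [← computablePred_iff_computable_decide, ComputablePred.computable_iff_re_compl_re]
  have hwm : Primrec fun x : List (Fin m) × Fin k => (x.1, e (ψ x.2)) :=
    Primrec.pair Primrec.fst ((Primrec.dom_finite fun a => e (ψ a)).comp Primrec.snd)
  constructor
  · have hre : REPred fun y : (Fin k × List (List (Fin m) × Fin kB)) ×
          List (List (Fin m) × Fin k) =>
        Q y.2 ∨ (∃ a, a ≠ y.1.1 ∧ y.2 = [([], a)]) ∨ ∃ g : List (Fin m),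
          y.2.map (fun x => (x.1, e (ψ x.2))) = y.1.2.map fun x => (g ++ x.1, x.2) := by
      refine (hQre.comp Primrec.snd).or (REPred.or (REPred.exists_snd (REPred.and ?_ ?_))
        (REPred.exists_snd ?_))
      · exact REPred.of_primrecPred (PrimrecPred.not (Primrec.eq.comp Primrec.snd
          (Primrec.fst.comp (Primrec.fst.comp Primrec.fst))))
      · refine REPred.of_primrecPred (Primrec.eq.comp (Primrec.snd.comp Primrec.fst) ?_)
        have : Primrec fun a : Fin k => [(([] : List (Fin m)), a)] :=
          Primrec.list_cons.comp (Primrec.pair (Primrec.const _) Primrec.id) (Primrec.const [])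
        exact this.comp Primrec.snd
      · refine REPred.of_primrecPred (Primrec.eq.comp ?_ ?_)
        · exact Primrec.list_map (Primrec.snd.comp Primrec.fst) (hwm.comp Primrec.snd)
        · refine Primrec.list_map (Primrec.snd.comp (Primrec.fst.comp Primrec.fst)) ?_
          exact Primrec.pair (Primrec.list_append.comp (Primrec.snd.comp Primrec.fst)
            (Primrec.fst.comp Primrec.snd)) (Primrec.snd.comp Primrec.snd)
    refine (REPred.exists_snd (p := fun (c : List (List (Fin m) × Fin kB)) (l : Fin k) =>
      ¬ ∃ z : List (Fin m) → Fin k, ∀ q, (Q q ∨ (∃ a, a ≠ l ∧ q = [([], a)]) ∨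
        ∃ g : List (Fin m), q.map (fun x => (x.1, e (ψ x.2))) = c.map fun x => (g ++ x.1, x.2)) →
        ¬ Matches z q) ((REPred.not_exists_avoiding (Q :=
          fun (y : Fin k × List (List (Fin m) × Fin kB)) (q : List (List (Fin m) × Fin k)) =>
          Q q ∨ (∃ a, a ≠ y.1 ∧ q = [([], a)]) ∨ ∃ g : List (Fin m),
          q.map (fun x => (x.1, e (ψ x.2))) = y.2.map fun x => (g ++ x.1, x.2)) hre).comp
            (Primrec.pair Primrec.snd Primrec.fst))).of_eq fun c => ?_
    constructor
    · rintro ⟨l, hl⟩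
      obtain ⟨w, hw, hw1⟩ := hall l
      by_contra hno
      refine hl ⟨fun u => w (u.map s).prod, fun q hq hzq => ?_⟩
      rcases hq with hq | ⟨a, ha, rfl⟩ | ⟨g, hg⟩
      · exact (hQ _).2 ⟨w, hw, fun _ => rfl⟩ q hq hzq
      · refine ha ?_
        have := hzq _ List.mem_cons_self
        simp only [List.map_nil, List.prod_nil] at this
        rw [← this, hw1]
      · refine hno ⟨ψ ∘ mulShift (g.map s).prod w, hWY ▸ ⟨_, W.mapsTo _ hw, rfl⟩, fun x hx => ?_⟩
        have : (g ++ x.1, x.2) ∈ q.map (fun x => (x.1, e (ψ x.2))) := by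
          rw [hg]; exact List.mem_map.2 ⟨x, hx, rfl⟩
        obtain ⟨x', hx', h'⟩ := List.mem_map.1 this
        have h1 := hzq x' hx'
        simp only [Prod.mk.injEq] at h'
        rw [h'.1] at h1
        rw [← h'.2, ← h1]
        simp
    · rintro ⟨y, hy, hyc⟩
      by_contra hno
      push Not at hno
      -- the configurations of `W` whose image contains no translate of the pattern `c`
      let W' : MulSubshift (Fin k) H :=
        { carrier := {w ∈ W.carrier | ∀ h : H,
            ¬ ∀ x ∈ c, e (ψ (w (h * (x.1.map s).prod))) = x.2}
          isClosed := by
            have : {w : H → Fin k | ∀ h : H, ¬ ∀ x ∈ c, e (ψ (w (h * (x.1.map s).prod))) = x.2} =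
                ⋂ h : H, {w | ∀ x ∈ c, e (ψ (w (h * (x.1.map s).prod))) = x.2}ᶜ := by
              ext w; simp
            refine W.isClosed.inter (this.symm ▸ isClosed_iInter fun h => IsOpen.isClosed_compl ?_ :
              IsClosed {w : H → Fin k | ∀ h : H,
                ¬ ∀ x ∈ c, e (ψ (w (h * (x.1.map s).prod))) = x.2})
            exact isOpen_setOf_forall_mem_list c (fun x => h * (x.1.map s).prod)
              fun x a => e (ψ a) = x.2
          mapsTo := fun g w hw => ⟨W.mapsTo g hw.1, fun h => by
            simpa [mul_assoc] using hw.2 (g * h)⟩ }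
      have hW' : ∀ a, ∃ w ∈ W'.carrier, w 1 = a := fun l => by
        obtain ⟨z, hz⟩ := hno l
        obtain ⟨w, hw, hzw⟩ := (hQ z).1 fun q hq => hz q (Or.inl hq)
        refine ⟨w, ⟨hw, fun h hh => ?_⟩, ?_⟩
        · obtain ⟨g, rfl⟩ := hsurj h
          refine hz (c.map fun x => (g ++ x.1, z (g ++ x.1))) (Or.inr (Or.inr ⟨g, ?_⟩)) ?_
          · rw [List.map_map]
            refine List.map_congr_left fun x hx => ?_
            have := hh x hx
            simp [hzw, this]
          · intro x hx
            obtain ⟨x', -, rfl⟩ := List.mem_map.1 hx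
            rfl
        · by_contra hne
          refine hz [([], w 1)] (Or.inr (Or.inl ⟨_, hne, rfl⟩)) ?_
          simp [Matches, hzw]
      have := hiso W' (fun w hw => hw.1) hW'
      rw [← this] at hy
      obtain ⟨w, hw, rfl⟩ := hy
      exact hw.2 1 (by simpa using hyc)
  · have hre : REPred fun y : List (List (Fin m) × Fin kB) × List (List (Fin m) × Fin k) =>
        Q y.2 ∨ ∃ x : List (Fin m) × Fin k, (∃ x' ∈ y.1, x'.1 = x.1 ∧ e (ψ x.2) ≠ x'.2) ∧
          y.2 = [x] := by
      refine (hQre.comp Primrec.snd).or (REPred.exists_snd (REPred.and ?_ ?_))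
      · have h1 : PrimrecRel fun (x' : List (Fin m) × Fin kB) (x : List (Fin m) × Fin k) =>
            x'.1 = x.1 ∧ e (ψ x.2) ≠ x'.2 :=
          PrimrecPred.and (Primrec.eq.comp (Primrec.fst.comp Primrec.fst)
            (Primrec.fst.comp Primrec.snd)) (PrimrecPred.not (Primrec.eq.comp
              (Primrec.snd.comp (hwm.comp Primrec.snd)) (Primrec.snd.comp Primrec.fst)))
        exact REPred.of_primrecPred (h1.exists_mem_list.comp (Primrec.fst.comp Primrec.fst)
          Primrec.snd)
      · exact REPred.of_primrecPred (Primrec.eq.comp (Primrec.snd.comp Primrec.fst)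
          (Primrec.list_cons.comp Primrec.snd (Primrec.const [])))
    refine (REPred.not_exists_avoiding (Q := fun (c : List (List (Fin m) × Fin kB)) q => Q q ∨
      ∃ x : List (Fin m) × Fin k, (∃ x' ∈ c, x'.1 = x.1 ∧ e (ψ x.2) ≠ x'.2) ∧ q = [x])
        hre).of_eq fun c => not_congr ?_
    rw [← hWY]
    constructor
    · rintro ⟨z, hz⟩
      obtain ⟨w, hw, hzw⟩ := (hQ z).1 fun q hq => hz q (Or.inl hq)
      refine ⟨_, ⟨w, hw, rfl⟩, fun x hx => ?_⟩
      by_contra hne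
      refine hz _ (Or.inr ⟨(x.1, w (x.1.map s).prod), ⟨x, hx, rfl, hne⟩, rfl⟩) ?_
      simp [Matches, hzw]
    · rintro ⟨_, ⟨w, hw, rfl⟩, hc⟩
      refine ⟨fun u => w (u.map s).prod, ?_⟩
      rintro q (hq | ⟨x, ⟨x', hx', h1, h2⟩, rfl⟩) hzq
      · exact (hQ _).2 ⟨w, hw, fun _ => rfl⟩ q hq hzq
      · refine h2 ?_
        have := hzq _ List.mem_cons_self
        rw [← this, ← hc x' hx', h1]
        rfl

/-! ### Group extensions -/

section Extension

variable {H G σ : Type*} [Group H] [Group G] [TopologicalSpace σ]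

/-- The pullback of a subshift along a surjective homomorphism. -/
def SymbolicDynamics.FullShift.MulSubshift.pullback [T2Space σ] (Z : MulSubshift σ G) (π : H →* G)
    (hπ : Function.Surjective π) : MulSubshift σ H where
  carrier := (fun z => z ∘ π) '' Z.carrier
  isClosed := by
    have : (fun z => z ∘ π) '' Z.carrier = (⋂ h : H, {x : H → σ | x h =
        x (Function.surjInv hπ (π h))}) ∩
          (fun x : H → σ => x ∘ Function.surjInv hπ) ⁻¹' Z.carrier := by
      ext x
      constructor
      · rintro ⟨z, hz, rfl⟩
        refine ⟨Set.mem_iInter.2 fun h => ?_, ?_⟩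
        · simp [Function.surjInv_eq hπ]
        · have : (z ∘ π) ∘ Function.surjInv hπ = z :=
            funext fun g => congrArg z (Function.surjInv_eq hπ g)
          simpa [this] using hz
      · rintro ⟨h1, h2⟩
        exact ⟨_, h2, funext fun h => (Set.mem_iInter.1 h1 h).symm⟩
    rw [this]
    refine IsClosed.inter (isClosed_iInter fun h => ?_) (Z.isClosed.preimage ?_)
    · exact isClosed_eq (continuous_apply _) (continuous_apply _)
    · exact continuous_pi fun g => continuous_apply _
  mapsTo := by
    rintro h _ ⟨z, hz, rfl⟩
    refine ⟨_, Z.mapsTo (π h) hz, funext fun g => ?_⟩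
    simp

/-- The configurations whose pullback along a surjective homomorphism lies in a given subshift. -/
def SymbolicDynamics.FullShift.MulSubshift.descend (Y : MulSubshift σ H) (π : H →* G)
    (hπ : Function.Surjective π) : MulSubshift σ G where
  carrier := (fun y => y ∘ π) ⁻¹' Y.carrier
  isClosed := Y.isClosed.preimage (continuous_pi fun h => continuous_apply _)
  mapsTo := by
    intro g y hy
    obtain ⟨h, rfl⟩ := hπ g
    have : (mulShift (π h) y) ∘ π = mulShift h (y ∘ π) := funext fun h' => by simp
    change (mulShift (π h) y) ∘ π ∈ Y.carrier
    rw [this]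
    exact Y.mapsTo h hy

/-- If the kernel is finitely generated, invariance under it is a local condition, and the
pullback of a subshift of finite type is again of finite type. -/
theorem IsSFT.pullback [T2Space σ] {Z : MulSubshift σ G} (hZ : IsSFT Z) (π : H →* G)
    (hπ : Function.Surjective π) (hker : π.ker.FG) : IsSFT (Z.pullback π hπ) := by
  classical
  obtain ⟨F, allowed, hF⟩ := hZ
  obtain ⟨T, hT⟩ := hker
  have hTker : ∀ t ∈ T, π t = 1 := fun t ht =>
    MonoidHom.mem_ker.1 (hT ▸ Subgroup.subset_closure ht)
  let lift := Function.surjInv hπ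
  have hlift : ∀ g, π (lift g) = g := Function.surjInv_eq hπ
  refine ⟨insert 1 (T ∪ F.image lift), {p | (∀ t ∈ T, ∀ (ht : t ∈ _) (h1 : (1 : H) ∈ _),
    p ⟨t, ht⟩ = p ⟨1, h1⟩) ∧ ∃ q ∈ allowed, ∀ (f : F) (hf : lift f ∈ _), p ⟨lift f, hf⟩ = q f},
    fun x => ⟨?_, fun hx => ?_⟩⟩
  · rintro ⟨z, hz, rfl⟩ h
    refine ⟨fun t ht _ _ => ?_, _, (hF z).1 hz (π h), fun f _ => ?_⟩
    · simp [hTker t ht]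
    · simp [hlift]
  · have hinv : ∀ k ∈ π.ker, ∀ h, x (h * k) = x h := by
      intro k hk
      rw [← hT] at hk
      induction hk using Subgroup.closure_induction with
      | mem t ht =>
        intro h
        have := (hx h).1 t ht (by simp [show t ∈ T from ht]) (by simp)
        simpa using this
      | one => simp
      | mul a b _ _ ha hb => intro h; rw [← mul_assoc, hb, ha]
      | inv a _ ha => intro h; rw [← ha (h * a⁻¹)]; simp
    have heq : ∀ h h', π h = π h' → x h = x h' := fun h h' hh => by
      rw [← hinv (h⁻¹ * h') (by simp [MonoidHom.mem_ker, hh]) h]; simp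
    refine ⟨x ∘ lift, (hF _).2 fun g => ?_, funext fun h => heq _ _ (hlift _)⟩
    obtain ⟨q, hq, hxq⟩ := (hx (lift g)).2
    convert hq using 1
    funext f
    rw [← hxq f (Finset.mem_insert_of_mem (Finset.mem_union_right _
      (Finset.mem_image_of_mem _ f.2)))]
    exact heq _ _ (by simp [hlift])

theorem IsFGRecursivelyPresented.countable (h : IsFGRecursivelyPresented H) : Countable H := by
  obtain ⟨n, π, R, hπ, -, -⟩ := h
  have : Countable (FreeGroup (Fin n)) :=
    (Quot.mk_surjective (r := FreeGroup.Red.Step (α := Fin n))).countable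
  exact hπ.countable

/-- A quotient of a recursively presented group by a finitely generated normal subgroup is
recursively presented. -/
theorem IsFGRecursivelyPresented.quotient (h : IsFGRecursivelyPresented H) (π : H →* G)
    (hπ : Function.Surjective π) (hker : π.ker.FG) : IsFGRecursivelyPresented G := by
  classical
  obtain ⟨n, π₀, R, hπ₀, hR, hRker⟩ := h
  obtain ⟨T, hT⟩ := hker
  have hword : ∀ t : H, ∃ w : List (Fin n × Bool), π₀ (FreeGroup.mk w) = t := fun t => by
    obtain ⟨x, rfl⟩ := hπ₀ t
    exact ⟨x.toWord, by rw [FreeGroup.mk_toWord]⟩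
  choose word hword using hword
  let L : List (List (Fin n × Bool)) := T.toList.map word
  refine ⟨n, π.comp π₀, R ∪ {w | w ∈ L}, hπ.comp hπ₀, hR.or ?_, le_antisymm ?_ fun x hx => ?_⟩
  · have h1 : PrimrecRel fun w' w : List (Fin n × Bool) => w' = w := Primrec.eq
    refine (REPred.of_primrecPred (h1.exists_mem_list.comp (Primrec.const L) Primrec.id)).of_eq ?_
    intro w
    simp
  · refine Subgroup.normalClosure_le_normal ?_
    rintro _ ⟨w, hw | hw, rfl⟩
    · have : FreeGroup.mk w ∈ π₀.ker := hRker ▸ Subgroup.subset_normalClosure ⟨w, hw, rfl⟩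
      simp [MonoidHom.mem_ker, MonoidHom.mem_ker.1 this]
    · obtain ⟨t, ht, rfl⟩ := List.mem_map.1 hw
      have : t ∈ π.ker := hT ▸ Subgroup.subset_closure (by simpa using ht)
      simpa [MonoidHom.mem_ker, hword] using this
  · have hle : π₀.ker ≤ Subgroup.normalClosure (FreeGroup.mk '' (R ∪ {w | w ∈ L})) := by
      rw [← hRker]
      exact Subgroup.normalClosure_mono (Set.image_mono Set.subset_union_left)
    have hle' : π.ker ≤
        (Subgroup.normalClosure (FreeGroup.mk '' (R ∪ {w | w ∈ L}))).map π₀ := by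
      rw [← hT, Subgroup.closure_le]
      intro t ht
      refine ⟨FreeGroup.mk (word t), Subgroup.subset_normalClosure ⟨_, Or.inr ?_, rfl⟩, hword t⟩
      exact List.mem_map.2 ⟨t, by simpa using ht, rfl⟩
    obtain ⟨y, hy, hyx⟩ := hle' (show π₀ x ∈ π.ker from hx)
    have h1 : x * y⁻¹ ∈ π₀.ker := by simp [MonoidHom.mem_ker, hyx]
    have := mul_mem (hle h1) hy
    simpa using this

/-- Decidability of the occurrence of patterns passes from a subshift over `H` to the subshift it
is pulled back from, since words over the generators of `H` also represent elements of `G`. -/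
theorem isEffective_descend {kB m : ℕ} {s : Fin m → H} (e : σ ≃ Fin kB) (Y : MulSubshift σ H)
    (π : H →* G) (hπ : Function.Surjective π)
    (hY : ∀ y ∈ Y.carrier, ∃ z : G → σ, y = z ∘ π)
    (hsymm : ∀ i, ∃ j, s j = (s i)⁻¹) (hgen : ∀ g, ∃ u : List (Fin m), (u.map s).prod = g)
    {alg : List (List (Fin m) × Fin kB) → Bool} (halg : Computable alg)
    (h : ∀ c, alg c = true ↔ ∃ y ∈ Y.carrier, ∀ x ∈ c, e (y (x.1.map s).prod) = x.2) :
    IsEffective (Y.descend π hπ) := by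
  have hprod : ∀ u : List (Fin m), (u.map (π ∘ s)).prod = π (u.map s).prod := fun u => by
    rw [map_list_prod, List.map_map]
  refine ⟨m, kB, π ∘ s, e, fun i => ?_, ?_, alg, halg, fun c F p hp => ?_⟩
  · obtain ⟨j, hj⟩ := hsymm i
    exact ⟨j, by simp [hj]⟩
  · refine eq_top_iff.2 fun g _ => ?_
    obtain ⟨g', rfl⟩ := hπ g
    obtain ⟨u, rfl⟩ := hgen g'
    rw [← hprod]
    refine Subgroup.list_prod_mem _ fun x hx => ?_
    obtain ⟨i, -, rfl⟩ := List.mem_map.1 hx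
    exact Subgroup.subset_closure ⟨i, rfl⟩
  · rw [h]
    constructor
    · rintro ⟨y, hy, hyc⟩
      obtain ⟨z, rfl⟩ := hY y hy
      refine ⟨z, hy, fun f => ?_⟩
      obtain ⟨w, hw, hwf⟩ := (hp f (p f)).2 ⟨f.2, rfl⟩
      have := hyc _ hw
      rw [Function.comp_apply, ← hprod, hwf] at this
      exact e.injective this
    · rintro ⟨z, hz, hzp⟩
      refine ⟨z ∘ π, hz, fun x hx => ?_⟩
      obtain ⟨hF, hpx⟩ := (hp (π (x.1.map s).prod) (e.symm x.2)).1 ⟨x.1, by simpa using hx, hprod _⟩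
      have := hzp ⟨_, hF⟩
      rw [hpx] at this
      simp [this]

end Extension

/-- The projectively isolated subshift inside the pullback of `Z` descends to an effective subshift
`Y` of `Z`. The part of `W` lying over finitely many of the subshifts into which `φ '' Y`
decomposes contains all letters once these finitely many are chosen well, so it is mapped onto `Y`,
which leaves no room for the others. -/
theorem not_hasSTRP_of_surjective {H G A B : Type*} [Group H] [Group G]
    [TopologicalSpace A]
    [Finite B] [TopologicalSpace B] [DiscreteTopology B]
    (X : MulSubshift A G) (Z : MulSubshift B G) (hZne : Z.carrier.Nonempty) (hZ : IsSFT Z)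
    (φ : (G → B) → (G → A)) (hφ : IsFactorMap φ Z X)
    (hunion : ∀ Y : MulSubshift B G, Y.carrier.Nonempty → Y.carrier ⊆ Z.carrier → IsEffective Y →
        IsInfiniteDisjointUnionOfProperSubshifts (φ '' Y.carrier))
    (π : H →* G) (hπ : Function.Surjective π)
    (hH : IsFGRecursivelyPresented H) (hker : π.ker.FG) : ¬ HasSTRP H := by
  intro hS
  have := hH.countable
  have hπinj : Function.Injective fun y : G → B => y ∘ π := hπ.injective_comp_right
  obtain ⟨Y', k, W, ψ, hY'Z, hk, hW, hall, hiso⟩ := hS.exists_projectivelyIsolated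
    (Z.pullback π hπ) (hZne.image _) (hZ.pullback π hπ hker)
  obtain ⟨kB, ⟨e⟩⟩ := Finite.exists_equiv_fin B
  obtain ⟨m, s, hsymm, hgen, alg, halg, halg'⟩ :=
    exists_computable_of_projectivelyIsolated hH e Y' W hW ψ hall hiso
  have hY' : ∀ y ∈ Y'.carrier, ∃ z, y = z ∘ π := fun y hy => by
    obtain ⟨z, -, hz⟩ := hY'Z hy
    exact ⟨z, hz.symm⟩
  let Y := Y'.descend π hπ
  have hYZ : Y.carrier ⊆ Z.carrier := fun y hy => by
    obtain ⟨z, hz, hzy⟩ := hY'Z hy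
    rwa [← hπinj hzy]
  have hWY : ∀ w ∈ W.carrier, ∃ y ∈ Y.carrier, ψ ∘ w = y ∘ π := fun w hw => by
    have h1 : ψ ∘ w ∈ Y'.carrier := (hiso W subset_rfl hall).subset ⟨w, hw, rfl⟩
    obtain ⟨z, hz⟩ := hY' _ h1
    exact ⟨z, show z ∘ π ∈ Y'.carrier from hz ▸ h1, hz⟩
  have hYne : Y.carrier.Nonempty := by
    obtain ⟨w, hw, -⟩ := hall (Classical.arbitrary _)
    obtain ⟨y, hy, -⟩ := hWY w hw
    exact ⟨y, hy⟩
  obtain ⟨𝒴, hinf, hsub, hdisj, hun⟩ := hunion Y hYne hYZ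
    (isEffective_descend e Y' π hπ hY' hsymm hgen halg halg')
  have hletter : ∀ a, ∃ w ∈ W.carrier, ∃ y ∈ Y.carrier, ψ ∘ w = y ∘ π ∧ w 1 = a ∧
      ∃ V ∈ 𝒴, φ y ∈ V.carrier := fun a => by
    obtain ⟨w, hw, hwa⟩ := hall a
    obtain ⟨y, hy, hwy⟩ := hWY w hw
    have : φ y ∈ ⋃ V ∈ 𝒴, V.carrier := hun ▸ ⟨y, hy, rfl⟩
    obtain ⟨V, hV, hyV⟩ := Set.mem_iUnion₂.1 this
    exact ⟨w, hw, y, hy, hwy, hwa, V, hV, hyV⟩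
  choose w hwW y hyY hwy hwa V hV𝒴 hyV using hletter
  -- the part of `W` lying over finitely many members of `𝒴`, enough to contain all letters
  let T : Set (G → A) := ⋃ a, (V a).carrier
  have hT : IsClosed T := isClosed_iUnion_of_finite fun a => (V a).isClosed
  have hYT : IsClosed {y ∈ Y.carrier | φ y ∈ T} :=
    (hφ.continuousOn.mono hYZ).preimage_isClosed_of_isClosed Y.isClosed hT
  have hTshift : ∀ g, ∀ x ∈ T, mulShift g x ∈ T := fun g x hx => by
    obtain ⟨a, ha⟩ := Set.mem_iUnion.1 hx
    exact Set.mem_iUnion.2 ⟨a, (V a).mapsTo g ha⟩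
  let YT : MulSubshift B G :=
    { carrier := {y ∈ Y.carrier | φ y ∈ T}
      isClosed := hYT
      mapsTo := fun g y hy => ⟨Y.mapsTo g hy.1, by
        rw [hφ.equivariant g y (hYZ hy.1)]
        exact hTshift g _ hy.2⟩ }
  let W' : MulSubshift (Fin k) H :=
    { carrier := W.carrier ∩ (ψ ∘ ·) ⁻¹' (YT.pullback π hπ).carrier
      isClosed := W.isClosed.inter ((YT.pullback π hπ).isClosed.preimage
        (continuous_pi fun h => continuous_of_discreteTopology.comp (continuous_apply h)))
      mapsTo := fun g w hw => ⟨W.mapsTo g hw.1, (YT.pullback π hπ).mapsTo g hw.2⟩ }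
  have hW' : (ψ ∘ ·) '' W'.carrier = Y'.carrier := by
    refine hiso W' (fun w hw => hw.1) fun a => ⟨w a, ⟨hwW a, y a, ⟨hyY a, ?_⟩, (hwy a).symm⟩, hwa a⟩
    exact Set.mem_iUnion.2 ⟨a, hyV a⟩
  -- a member of `𝒴` outside the finite family is disjoint from `T`
  obtain ⟨V', hV', hV'V⟩ := hinf.exists_notMem_finite (Set.finite_range V)
  obtain ⟨x, hx⟩ := (hsub V' hV').1
  obtain ⟨y', hy', rfl⟩ := (hsub V' hV').2.1 hx
  have h1 : y' ∘ π ∈ (ψ ∘ ·) '' W'.carrier := hW'.symm ▸ hy'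
  obtain ⟨w', ⟨-, y'', hy'', h2⟩, h3⟩ := h1
  obtain rfl : y'' = y' := hπinj (h2.trans h3)
  obtain ⟨a, ha⟩ := Set.mem_iUnion.1 hy''.2
  exact Set.disjoint_left.1 (hdisj hV' (hV𝒴 a) fun h => hV'V ⟨a, h.symm⟩) hx ha

theorem mainTheorem7 {N H G A B : Type*} [Group N] [Group H] [Group G] [Countable G]
    [Finite A] [Nontrivial A] [TopologicalSpace A] [DiscreteTopology A]
    [Finite B] [Nontrivial B] [TopologicalSpace B] [DiscreteTopology B]
    (X : SymbolicDynamics.FullShift.MulSubshift A G)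
    (Z : SymbolicDynamics.FullShift.MulSubshift B G)
    (hZne : Z.carrier.Nonempty) (hZ : IsSFT Z)
    (φ : (G → B) → (G → A)) (hφ : IsFactorMap φ Z X)
    (hunion : ∀ Y : SymbolicDynamics.FullShift.MulSubshift B G,
      Y.carrier.Nonempty → Y.carrier ⊆ Z.carrier → IsEffective Y →
        IsInfiniteDisjointUnionOfProperSubshifts (φ '' Y.carrier))
    (i : N →* H) (π : H →* G) (hi : Function.Injective i) (hπ : Function.Surjective π)
    (hexact : i.range = π.ker) (hH : IsFGRecursivelyPresented H) (hN : Group.FG N) :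
    ¬ HasSTRP H ∧ ¬ HasSTRP G := by
  have hker : π.ker.FG := by
    rw [← hexact]
    exact (Group.fg_iff_subgroup_fg _).1 inferInstance
  refine ⟨not_hasSTRP_of_surjective X Z hZne hZ φ hφ hunion π hπ hH hker,
    not_hasSTRP_of_surjective X Z hZne hZ φ hφ hunion (MonoidHom.id G) Function.surjective_id
      (hH.quotient π hπ hker) ?_⟩
  rw [MonoidHom.ker_id]
  exact ⟨∅, by simp⟩
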